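/- Use units with $8\pi G=c=1$. Let $I,J\subset\mathbb R$ be non-empty open intervals, let $\kappa,c_v>0$ and put $\gamma=1+\kappa/c_v$. For $k\in\{1,0,-1\}$ and smooth functions $\lambda,Y$ on $I\times J$ with $Y>0$ and $Y'=\partial_rY\neq0$ everywhere, consider the metric with a three-dimensional isometry group acting on two-dimensional space-like orbits $$ds^2=-dt^2+e^{2\lambda(t,r)}dr^2+Y(t,r)^2\,d\Omega_k^2,\qquad d\Omega_k^2=d\theta^2+S_k(\theta)^2d\varphi^2,\quad S_1=\sin,\ S_0=\mathrm{id},\ S_{-1}=\sinh,$$ for $t\in I$, $r\in J$, $\theta>0$ (and $\theta<\pi$ if $k=1$), $\varphi\in\mathbb R$. Let it solve the Einstein equations $G_{ab}=(\rho+p)u_au_b+p\,g_{ab}$ for a perfect fluid with velocity $u=\partial_t$ (comoving, hence in geodesic motion), energy density $\rho$ and pressure $p$. The solution is a *classical ideal gas in local thermal equilibrium* with constants $\kappa,c_v$ if there are smooth functions $n>0$, $\epsilon$, $\Theta>0$, $s$ on space-time with $$\rho=n(1+\epsilon),\quad \nabla\!\cdot(nu)=0,\quad \Theta\,ds=d\epsilon+p\,d(1/n),\quad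 p=\kappa n\Theta,\quad \epsilon=c_v\Theta .$$ A *classical ideal gas FLRW model* with adiabatic index $\gamma$ on $I$ is given by $\varepsilon\in\{0,1,-1\}$, constants $n_0,p_0,R_0>0$ and a smooth function $R>0$ on $I$ such that $$\frac{3\dot R^2}{R^2}+\frac{3\varepsilon}{R^2}=\rho(R):=n_0\Big(\frac{R_0}{R}\Big)^3+\frac{p_0}{\gamma-1}\Big(\frac{R_0}{R}\Big)^{3\gamma},\qquad -\frac{2\ddot R}{R}-\frac{\dot R^2}{R^2}-\frac{\varepsilon}{R^2}=p(R):=p_0\Big(\frac{R_0}{R}\Big)^{3\gamma};$$ its metric is $$ds^2=-dt^2+\frac{R(t)^2}{(1+\frac14\varepsilon r^2)^2}\,(dr^2+r^2d\Omega_1^2),$$ where $dr^2+r^2d\Omega_1^2$ is the Euclidean metric of $\mathbb R^3$ (and the metric is considered where $1+\frac14\varepsilon r^2>0$). The solutions of the above class which can be interpreted as classical ideal gases are the classical ideal gas FLRW models: (i) If a metric of the above class is a perfect fluid solution that is a classical ideal gas with constants $\kappa,c_v$ and quantities $\rho,p,n,\epsilon,\Theta,s$, then there are a classical ideal gas FLRW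 model with adiabatic index $\gamma$ on $I$ and a smooth map preserving $t$, from the coordinate domain to the domain of the FLRW metric, under which the FLRW metric pulls back to the given one. Moreover $$\rho=\rho(R),\quad p=p(R),\quad n=n_0\Big(\frac{R_0}{R}\Big)^3,\quad \Theta=\frac{p_0}{\kappa n_0}\Big(\frac{R_0}{R}\Big)^{3(\gamma-1)},\qquad R=R(t).$$ (ii) Conversely, given a classical ideal gas FLRW model with adiabatic index $\gamma$ on $I$, suppose that $r>0$, $1+\frac14\varepsilon r^2>0$ and $1-\frac14\varepsilon r^2\neq0$ for all $r\in J$. Then its metric in isotropic spherical coordinates, i.e. the metric of the above class with $k=1$, $e^{\lambda}=R/(1+\frac14\varepsilon r^2)$ and $Y=rR/(1+\frac14\varepsilon r^2)$, belongs to the class, and it is a perfect fluid solution and a classical ideal gas with constants $\kappa,c_v$ and with $\rho,p,n,\Theta$ given by the formulas in (i) for suitable $\epsilon,s$. -/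

import Mathlib

open scoped ContDiff

noncomputable section

namespace CIG

/-! ## Tensor calculus in a coordinate patch of a four-dimensional space-time -/

/-- Coordinates on space-time; index `0` is the time coordinate. -/
abbrev Coord : Type := Fin 4 → ℝ

/-- A metric tensor in coordinates. -/
abbrev Metric : Type := Coord → Matrix (Fin 4) (Fin 4) ℝ

/-- The partial derivative `∂ᵢ f`. -/
def pd (i : Fin 4) (f : Coord → ℝ) (x : Coord) : ℝ :=
  deriv (fun s : ℝ => f (Function.update x i s)) (x i)

/-- The Christoffel symbols `Γᵃ_{bc}` of the Levi-Civita connection. -/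
def christoffel (g : Metric) (a b c : Fin 4) (x : Coord) : ℝ :=
  (1 / 2) * ∑ d, (g x)⁻¹ a d *
    (pd b (fun y => g y d c) x + pd c (fun y => g y d b) x - pd d (fun y => g y b c) x)

/-- The Ricci tensor `R_{bc}`. -/
def ricci (g : Metric) (b c : Fin 4) (x : Coord) : ℝ :=
  ∑ a, (pd a (christoffel g a b c) x - pd c (christoffel g a b a) x
    + ∑ d, (christoffel g a a d x * christoffel g d b c x
      - christoffel g a c d x * christoffel g d b a x))

/-- The scalar curvature. -/
def scalarCurvature (g : Metric) (x : Coord) : ℝ :=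
  ∑ b, ∑ c, (g x)⁻¹ b c * ricci g b c x

/-- The Einstein tensor `G_{bc} = R_{bc} - (1/2) R g_{bc}`. -/
def einstein (g : Metric) (b c : Fin 4) (x : Coord) : ℝ :=
  ricci g b c x - (1 / 2) * scalarCurvature g x * g x b c

/-- The covariant divergence `∇ₐ vᵃ` of a vector field. -/
def divergence (g : Metric) (v : Coord → Coord) (x : Coord) : ℝ :=
  ∑ a, (pd a (fun y => v y a) x + ∑ b, christoffel g a a b x * v x b)

/-- The pull-back of a metric by a map `Ψ`. -/
def pullback (Ψ : Coord → Coord) (g : Metric) : Metric := fun x =>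
  Matrix.of fun i j =>
    ∑ a, ∑ b, pd i (fun y => Ψ y a) x * pd j (fun y => Ψ y b) x * g (Ψ x) a b

/-! ## Perfect fluids and classical ideal gases -/

/-- On the region `D`, the metric `g` is a solution of the Einstein equations (units with
`8πG = c = 1`) whose source is the perfect fluid of unit velocity `u`, energy density `ρ` and
pressure `p`. -/
structure IsPerfectFluidSolution (g : Metric) (D : Set Coord) (u : Coord → Coord)
    (ρ p : Coord → ℝ) : Prop where
  smooth_rho : ContDiffOn ℝ ∞ ρ D
  smooth_p : ContDiffOn ℝ ∞ p D
  unit : ∀ x ∈ D, ∑ a, ∑ b, g x a b * u x a * u x b = -1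
  field_eq : ∀ x ∈ D, ∀ b c : Fin 4,
    einstein g b c x =
      (ρ x + p x) * (∑ a, g x b a * u x a) * (∑ a, g x c a * u x a) + p x * g x b c

/-- The perfect fluid `(u, ρ, p)` evolves, on the region `D`, in local thermal equilibrium as a
classical ideal gas with constants `κ` (Boltzmann constant over particle mass) and `cᵥ` (heat
capacity at constant volume); `n`, `e`, `Θ`, `s` are the matter density, the specific internal
energy, the absolute temperature and the specific entropy. -/
structure IsClassicalIdealGas (g : Metric) (D : Set Coord) (u : Coord → Coord)
    (ρ p : Coord → ℝ) (κ cᵥ : ℝ) (n e Θ s : Coord → ℝ) : Prop where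
  kappa_pos : 0 < κ
  cv_pos : 0 < cᵥ
  smooth_n : ContDiffOn ℝ ∞ n D
  smooth_e : ContDiffOn ℝ ∞ e D
  smooth_temp : ContDiffOn ℝ ∞ Θ D
  smooth_s : ContDiffOn ℝ ∞ s D
  n_pos : ∀ x ∈ D, 0 < n x
  temp_pos : ∀ x ∈ D, 0 < Θ x
  /-- decomposition of the energy density -/
  energy : ∀ x ∈ D, ρ x = n x * (1 + e x)
  /-- conservation of matter -/
  matter : ∀ x ∈ D, divergence g (fun y a => n y * u y a) x = 0
  /-- the local thermal equilibrium equation `Θ ds = de + p d(1/n)` -/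
  equilibrium : ∀ x ∈ D, ∀ i : Fin 4,
    Θ x * pd i s x = pd i e x + p x * pd i (fun y => 1 / n y) x
  /-- the ideal gas law -/
  ideal : ∀ x ∈ D, p x = κ * n x * Θ x
  /-- the caloric equation of state -/
  caloric : ∀ x ∈ D, e x = cᵥ * Θ x

/-- The adiabatic index. -/
def adiabaticIndex (κ cᵥ : ℝ) : ℝ := 1 + κ / cᵥ

/-! ## Metrics with a three-dimensional isometry group on two-dimensional space-like orbits -/

/-- The function `S` for which `dθ² + S(θ)² dφ²` has constant curvature `k = 1, 0, -1`. -/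
def orbitRadius : SignType → ℝ → ℝ
  | .pos, θ => Real.sin θ
  | .zero, θ => θ
  | .neg, θ => Real.sinh θ

/-- The metric `-dt² + e^{2 lam(t,r)} dr² + Y(t,r)² (dθ² + S(θ)² dφ²)` in the coordinates
`(t, r, θ, φ)`, where the orbits have curvature of sign `k`. -/
def orbitMetric (k : SignType) (lam Y : ℝ → ℝ → ℝ) : Metric := fun x =>
  Matrix.diagonal
    ![-1,
      Real.exp (2 * lam (x 0) (x 1)),
      Y (x 0) (x 1) ^ 2,
      Y (x 0) (x 1) ^ 2 * orbitRadius k (x 2) ^ 2]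

/-- The coordinate patch: `t ∈ I`, `r ∈ J`, and `(θ, φ)` polar coordinates on the orbit. -/
def patch (k : SignType) (I J : Set ℝ) : Set Coord :=
  {x | x 0 ∈ I ∧ x 1 ∈ J ∧ 0 < x 2 ∧ (k = .pos → x 2 < Real.pi)}

/-- The vector field `∂_t`: the unit velocity of a fluid that is comoving with these coordinates
(and then in geodesic motion). -/
def comoving : Coord → Coord := fun _ => Pi.single 0 1

/-- The metric functions are smooth, `Y` is positive and `∂Y/∂r` has no zero. -/
structure IsAdmissible (I J : Set ℝ) (lam Y : ℝ → ℝ → ℝ) : Prop where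
  smooth_lam : ContDiffOn ℝ ∞ (fun q : ℝ × ℝ => lam q.1 q.2) (I ×ˢ J)
  smooth_Y : ContDiffOn ℝ ∞ (fun q : ℝ × ℝ => Y q.1 q.2) (I ×ˢ J)
  Y_pos : ∀ t ∈ I, ∀ r ∈ J, 0 < Y t r
  Y_r_ne_zero : ∀ t ∈ I, ∀ r ∈ J, deriv (fun r' => Y t r') r ≠ 0

/-! ## The classical ideal gas FLRW models -/

/-- The conformal factor `1 + ε |x|² / 4` of the isotropic form of a space of curvature `ε`. -/
def isotropicFactor (ε : SignType) (x : Coord) : ℝ :=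
  1 + (ε : ℝ) / 4 * (x 1 ^ 2 + x 2 ^ 2 + x 3 ^ 2)

/-- The FLRW metric `-dt² + R(t)² (1 + ε r²/4)⁻² (dr² + r² dΩ²)`, with the Euclidean metric
`dr² + r² dΩ²` written in Cartesian coordinates. -/
def flrwMetric (ε : SignType) (R : ℝ → ℝ) : Metric := fun x =>
  Matrix.diagonal
    ![-1,
      R (x 0) ^ 2 / isotropicFactor ε x ^ 2,
      R (x 0) ^ 2 / isotropicFactor ε x ^ 2,
      R (x 0) ^ 2 / isotropicFactor ε x ^ 2]

/-- Matter density at expansion factor `R`. -/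
def modelMatter (n₀ R₀ R : ℝ) : ℝ := n₀ * (R₀ / R) ^ 3

/-- Pressure at expansion factor `R`. -/
def modelPressure (γ p₀ R₀ R : ℝ) : ℝ := p₀ * (R₀ / R) ^ (3 * γ)

/-- Energy density at expansion factor `R`. -/
def modelEnergy (γ n₀ p₀ R₀ R : ℝ) : ℝ :=
  n₀ * (R₀ / R) ^ 3 + p₀ / (γ - 1) * (R₀ / R) ^ (3 * γ)

/-- Temperature at expansion factor `R`. -/
def modelTemperature (κ γ n₀ p₀ R₀ R : ℝ) : ℝ :=
  p₀ / (κ * n₀) * (R₀ / R) ^ (3 * (γ - 1))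

/-- `R` is the expansion factor, on the time interval `I`, of a classical ideal gas FLRW model of
spatial curvature `ε`. The second Einstein equation follows from the generalized Friedmann equation
where `R` is not stationary; it is listed because the latter has spurious constant solutions. -/
structure IsFLRWModel (ε : SignType) (γ n₀ p₀ R₀ : ℝ) (I : Set ℝ) (R : ℝ → ℝ) : Prop where
  n₀_pos : 0 < n₀
  p₀_pos : 0 < p₀
  R₀_pos : 0 < R₀
  smooth : ContDiffOn ℝ ∞ R I
  pos : ∀ t ∈ I, 0 < R t
  friedmann : ∀ t ∈ I,
    3 * deriv R t ^ 2 / R t ^ 2 + 3 * (ε : ℝ) / R t ^ 2 = modelEnergy γ n₀ p₀ R₀ (R t)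
  pressure : ∀ t ∈ I,
    -(2 * deriv (deriv R) t / R t) - deriv R t ^ 2 / R t ^ 2 - (ε : ℝ) / R t ^ 2
      = modelPressure γ p₀ R₀ (R t)

end CIG

end

/-!
The metric functions depend on `(t, r)` only, so the Einstein equations are four equations for
`λ`, `Y`, the pressure `p` and the matter density `n` on `I × J` (`CIG.ReducedSystem`). The `tr`
equation says that `F = e^{-2λ} Y'²` is independent of `t`, and then the `rr` and the angular
equations give `p' = 0` (`dr_P`).

The caloric equation of state and the gas law turn the energy density into `n + p / (γ - 1)`. Since
both the energy and the matter are conserved along the fluid lines, `ṗ = -γ p H`, where `H` is the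
expansion; as `p` is positive and homogeneous, so is `H` (`dr_expansion`). By the `tr` equation the
shear, multiplied by the volume factor `Y³`, is a function `c` of `t` alone (`dr_shear`), and the
Raychaudhuri equation writes `n` as a homogeneous function minus `4c² / (3Y⁶)`
(`matter_density_eq`). Comparing this with `ṅ = -H n` leaves a polynomial identity in `Y⁻³` whose
coefficients depend on `t` alone and whose leading coefficient is a multiple of `c³`
(`shear_evolution`). Because `Y' ≠ 0`, `Y` takes an interval of values at fixed `t`, whence `c = 0`
(`shear_eq_zero`).

Without shear `Y = R(t) M(r)`, and the `rr` equation yields `k - F = ε M²` after a rescaling of `R`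
by a constant, so that the slices `t = const` have the metric
`R² (M'² dr² / (k - ε M²) + M² (dθ² + S² dφ²))` of constant curvature (`exists_model`). The map to
the FLRW metric is the stereographic projection of the quadric `W² + ε |X|² = 1`, in which the
slice is embedded in spherical, hyperbolic or horospherical coordinates according to `k`
(`CIG.exists_spaceFormMap`, `CIG.IsSpaceFormMap.pullback_stereographic`).

The converse is a computation of the Einstein tensor in isotropic spherical coordinates
(`CIG.IsFLRWModel.einsteinBase_eq`). There the specific entropy is constant.
-/

namespace CIG

open Set

/-! ### Partial derivatives of functions of two variables -/

/-- The partial derivative of `F (t, r)` with respect to `t`. -/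
noncomputable def dt (F : ℝ → ℝ → ℝ) : ℝ → ℝ → ℝ := fun t r => deriv (fun t' => F t' r) t

/-- The partial derivative of `F (t, r)` with respect to `r`. -/
noncomputable def dr (F : ℝ → ℝ → ℝ) : ℝ → ℝ → ℝ := fun t r => deriv (fun r' => F t r') r

/-- `F` is smooth, as a function of two variables, on `I × J`. -/
def SmoothOn₂ (I J : Set ℝ) (F : ℝ → ℝ → ℝ) : Prop :=
  ContDiffOn ℝ ∞ (fun q : ℝ × ℝ => F q.1 q.2) (I ×ˢ J)

theorem _root_.HasFDerivAt.hasDerivAt_left {E : Type*} [NormedAddCommGroup E] [NormedSpace ℝ E]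
    {G : ℝ × ℝ → E} {G' : ℝ × ℝ →L[ℝ] E} {t r : ℝ} (h : HasFDerivAt G G' (t, r)) :
    HasDerivAt (fun t' => G (t', r)) (G' (1, 0)) t :=
  HasFDerivAt.comp_hasDerivAt (f := fun t' => (t', r)) t h
    ((hasDerivAt_id t).prodMk (hasDerivAt_const t r))

theorem _root_.HasFDerivAt.hasDerivAt_right {E : Type*} [NormedAddCommGroup E] [NormedSpace ℝ E]
    {G : ℝ × ℝ → E} {G' : ℝ × ℝ →L[ℝ] E} {t r : ℝ} (h : HasFDerivAt G G' (t, r)) :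
    HasDerivAt (fun r' => G (t, r')) (G' (0, 1)) r :=
  HasFDerivAt.comp_hasDerivAt (f := fun r' => (t, r')) r h
    ((hasDerivAt_const r t).prodMk (hasDerivAt_id r))

theorem _root_.HasDerivAt.clm_apply_const {E : Type*} [NormedAddCommGroup E] [NormedSpace ℝ E]
    {c : ℝ → E →L[ℝ] ℝ} {c' : E →L[ℝ] ℝ} {x : ℝ} (h : HasDerivAt c c' x) (v : E) :
    HasDerivAt (fun y => c y v) (c' v) x := by
  simpa using h.clm_apply (hasDerivAt_const x v)

namespace SmoothOn₂

variable {I J : Set ℝ} {F : ℝ → ℝ → ℝ} {t r : ℝ}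

theorem contDiffAt (hF : SmoothOn₂ I J F) (hI : IsOpen I) (hJ : IsOpen J) (ht : t ∈ I)
    (hr : r ∈ J) : ContDiffAt ℝ ∞ (fun q : ℝ × ℝ => F q.1 q.2) (t, r) :=
  ContDiffOn.contDiffAt hF ((hI.prod hJ).mem_nhds ⟨ht, hr⟩)

theorem hasFDerivAt (hF : SmoothOn₂ I J F) (hI : IsOpen I) (hJ : IsOpen J) (ht : t ∈ I)
    (hr : r ∈ J) : HasFDerivAt (fun q : ℝ × ℝ => F q.1 q.2)
      (fderiv ℝ (fun q : ℝ × ℝ => F q.1 q.2) (t, r)) (t, r) :=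
  ((hF.contDiffAt hI hJ ht hr).differentiableAt (by simp)).hasFDerivAt

theorem hasDerivAt_fderiv_left (hF : SmoothOn₂ I J F) (hI : IsOpen I) (hJ : IsOpen J)
    (ht : t ∈ I) (hr : r ∈ J) : HasDerivAt (fun t' => F t' r)
      (fderiv ℝ (fun q : ℝ × ℝ => F q.1 q.2) (t, r) (1, 0)) t :=
  (hF.hasFDerivAt hI hJ ht hr).hasDerivAt_left

theorem hasDerivAt_fderiv_right (hF : SmoothOn₂ I J F) (hI : IsOpen I) (hJ : IsOpen J)
    (ht : t ∈ I) (hr : r ∈ J) : HasDerivAt (fun r' => F t r')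
      (fderiv ℝ (fun q : ℝ × ℝ => F q.1 q.2) (t, r) (0, 1)) r :=
  (hF.hasFDerivAt hI hJ ht hr).hasDerivAt_right

theorem hasDerivAt_dt (hF : SmoothOn₂ I J F) (hI : IsOpen I) (hJ : IsOpen J) (ht : t ∈ I)
    (hr : r ∈ J) : HasDerivAt (fun t' => F t' r) (dt F t r) t :=
  (hF.hasDerivAt_fderiv_left hI hJ ht hr).differentiableAt.hasDerivAt

theorem hasDerivAt_dr (hF : SmoothOn₂ I J F) (hI : IsOpen I) (hJ : IsOpen J) (ht : t ∈ I)
    (hr : r ∈ J) : HasDerivAt (fun r' => F t r') (dr F t r) r :=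
  (hF.hasDerivAt_fderiv_right hI hJ ht hr).differentiableAt.hasDerivAt

theorem dt_eq (hF : SmoothOn₂ I J F) (hI : IsOpen I) (hJ : IsOpen J) (ht : t ∈ I)
    (hr : r ∈ J) : dt F t r = fderiv ℝ (fun q : ℝ × ℝ => F q.1 q.2) (t, r) (1, 0) :=
  (hF.hasDerivAt_fderiv_left hI hJ ht hr).deriv

theorem dr_eq (hF : SmoothOn₂ I J F) (hI : IsOpen I) (hJ : IsOpen J) (ht : t ∈ I)
    (hr : r ∈ J) : dr F t r = fderiv ℝ (fun q : ℝ × ℝ => F q.1 q.2) (t, r) (0, 1) :=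
  (hF.hasDerivAt_fderiv_right hI hJ ht hr).deriv

theorem dt_smooth (hF : SmoothOn₂ I J F) (hI : IsOpen I) (hJ : IsOpen J) :
    SmoothOn₂ I J (dt F) :=
  ((ContDiffOn.fderiv_of_isOpen (m := ∞) hF (hI.prod hJ) (by simp)).clm_apply
    contDiffOn_const).congr fun _ hq => hF.dt_eq hI hJ hq.1 hq.2

theorem dr_smooth (hF : SmoothOn₂ I J F) (hI : IsOpen I) (hJ : IsOpen J) :
    SmoothOn₂ I J (dr F) :=
  ((ContDiffOn.fderiv_of_isOpen (m := ∞) hF (hI.prod hJ) (by simp)).clm_apply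
    contDiffOn_const).congr fun _ hq => hF.dr_eq hI hJ hq.1 hq.2

/-- Mixed partial derivatives commute. -/
theorem dt_dr (hF : SmoothOn₂ I J F) (hI : IsOpen I) (hJ : IsOpen J) (ht : t ∈ I)
    (hr : r ∈ J) : dt (dr F) t r = dr (dt F) t r := by
  set G : ℝ × ℝ → ℝ := fun q => F q.1 q.2 with hG
  have two_le : (2 : WithTop ℕ∞) ≤ ∞ := WithTop.coe_le_coe.2 (le_top : (2 : ℕ∞) ≤ ⊤)
  have hsym : IsSymmSndFDerivAt ℝ G (t, r) :=
    (hF.contDiffAt hI hJ ht hr).isSymmSndFDerivAt (by simpa using two_le)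
  have hd : HasFDerivAt (fderiv ℝ G) (fderiv ℝ (fderiv ℝ G) (t, r)) (t, r) :=
    (((hF.contDiffAt hI hJ ht hr).fderiv_right (m := 1) (by simpa [one_add_one_eq_two] using two_le)
      ).differentiableAt (by simp)).hasFDerivAt
  have h1 : HasDerivAt (fun t' => dr F t' r) (fderiv ℝ (fderiv ℝ G) (t, r) (1, 0) (0, 1)) t := by
    refine (hd.hasDerivAt_left.clm_apply_const (0, 1)).congr_of_eventuallyEq ?_
    filter_upwards [hI.mem_nhds ht] with t' ht'
    exact hF.dr_eq hI hJ ht' hr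
  have h2 : HasDerivAt (fun r' => dt F t r') (fderiv ℝ (fderiv ℝ G) (t, r) (0, 1) (1, 0)) r := by
    refine (hd.hasDerivAt_right.clm_apply_const (1, 0)).congr_of_eventuallyEq ?_
    filter_upwards [hJ.mem_nhds hr] with r' hr'
    exact hF.dt_eq hI hJ ht hr'
  exact h1.deriv.trans ((hsym.eq _ _).trans h2.deriv.symm)

end SmoothOn₂

/-- Functions that agree on `I × J` have the same `t`-derivative there. -/
theorem dt_congr {I J : Set ℝ} {F G : ℝ → ℝ → ℝ} (hI : IsOpen I)
    (h : ∀ t ∈ I, ∀ r ∈ J, F t r = G t r) {t r : ℝ} (ht : t ∈ I) (hr : r ∈ J) :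
    dt F t r = dt G t r :=
  Filter.EventuallyEq.deriv_eq (by filter_upwards [hI.mem_nhds ht] with s hs using h s hs r hr)

/-- Functions that agree on `I × J` have the same `r`-derivative there. -/
theorem dr_congr {I J : Set ℝ} {F G : ℝ → ℝ → ℝ} (hJ : IsOpen J)
    (h : ∀ t ∈ I, ∀ r ∈ J, F t r = G t r) {t r : ℝ} (ht : t ∈ I) (hr : r ∈ J) :
    dr F t r = dr G t r :=
  Filter.EventuallyEq.deriv_eq (by filter_upwards [hJ.mem_nhds hr] with s hs using h t ht s hs)

/-! ### Partial derivatives on space-time -/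

/-- Partial derivatives of a product of a function of `(t, r)` and a function of `θ`. -/
theorem pd_prod (F : ℝ → ℝ → ℝ) (G : ℝ → ℝ) (i : Fin 4) (x : Coord) :
    pd i (fun y => F (y 0) (y 1) * G (y 2)) x =
      ![dt F (x 0) (x 1) * G (x 2), dr F (x 0) (x 1) * G (x 2),
        F (x 0) (x 1) * deriv G (x 2), 0] i := by
  fin_cases i <;> simp [pd, dt, dr]

theorem pd_congr {D : Set Coord} (hD : IsOpen D) {f g : Coord → ℝ} (h : ∀ y ∈ D, f y = g y)
    {x : Coord} (hx : x ∈ D) (i : Fin 4) : pd i f x = pd i g x := by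
  refine Filter.EventuallyEq.deriv_eq ?_
  have hc : ContinuousAt (fun s : ℝ => Function.update x i s) (x i) := by fun_prop
  have : D ∈ nhds (Function.update x i (x i)) := by
    simpa using hD.mem_nhds hx
  filter_upwards [hc this] with s hs using h _ hs

theorem isOpen_patch (k : SignType) {I J : Set ℝ} (hI : IsOpen I) (hJ : IsOpen J) :
    IsOpen (patch k I J) := by
  have h : patch k I J = {x | x 0 ∈ I} ∩ ({x | x 1 ∈ J} ∩ ({x | 0 < x 2} ∩
      {x | k = .pos → x 2 < Real.pi})) := rfl
  rw [h]
  refine (hI.preimage (continuous_apply 0)).inter ((hJ.preimage (continuous_apply 1)).inter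
    ((isOpen_lt continuous_const (continuous_apply 2)).inter ?_))
  by_cases hk : k = .pos
  · simpa only [hk, forall_const] using isOpen_lt (continuous_apply (2 : Fin 4)) continuous_const
  · simp only [hk, false_imp_iff, ofPred_true, isOpen_univ]

/-! ### The orbits -/

/-- The derivative of `orbitRadius k`. -/
noncomputable def orbitCos : SignType → ℝ → ℝ
  | .pos, θ => Real.cos θ
  | .zero, _ => 1
  | .neg, θ => Real.cosh θ

theorem hasDerivAt_orbitRadius (k : SignType) (θ : ℝ) :
    HasDerivAt (orbitRadius k) (orbitCos k θ) θ := by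
  cases k
  · exact hasDerivAt_id θ
  · exact Real.hasDerivAt_sinh θ
  · exact Real.hasDerivAt_sin θ

theorem hasDerivAt_orbitCos (k : SignType) (θ : ℝ) :
    HasDerivAt (orbitCos k) (-(k : ℝ) * orbitRadius k θ) θ := by
  cases k
  · exact (hasDerivAt_const θ (1 : ℝ)).congr_deriv (by simp)
  · exact (Real.hasDerivAt_cosh θ).congr_deriv (by simp [orbitRadius])
  · exact (Real.hasDerivAt_cos θ).congr_deriv (by simp [orbitRadius])

theorem orbitRadius_pos {k : SignType} {I J : Set ℝ} {x : Coord} (hx : x ∈ patch k I J) :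
    0 < orbitRadius k (x 2) := by
  obtain ⟨-, -, h2, h3⟩ := hx
  cases k
  · exact h2
  · exact Real.sinh_pos_iff.2 h2
  · exact Real.sin_pos_of_pos_of_lt_pi h2 (h3 rfl)

/-! ### Curvature of the metrics with two-dimensional orbits -/

/-- The `(t, r)`-dependent factor of the Christoffel symbol `Γᵃ_{bc}` of `orbitMetric k lam Y`. -/
noncomputable def christoffelBase (lam Y : ℝ → ℝ → ℝ) :
    Fin 4 → Fin 4 → Fin 4 → ℝ → ℝ → ℝ :=
  ![![![fun _ _ => 0, fun _ _ => 0, fun _ _ => 0, fun _ _ => 0],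
      ![fun _ _ => 0, fun t r => Real.exp (2 * lam t r) * dt lam t r, fun _ _ => 0, fun _ _ => 0],
      ![fun _ _ => 0, fun _ _ => 0, fun t r => Y t r * dt Y t r, fun _ _ => 0],
      ![fun _ _ => 0, fun _ _ => 0, fun _ _ => 0, fun t r => Y t r * dt Y t r]],
    ![![fun _ _ => 0, fun t r => dt lam t r, fun _ _ => 0, fun _ _ => 0],
      ![fun t r => dt lam t r, fun t r => dr lam t r, fun _ _ => 0, fun _ _ => 0],
      ![fun _ _ => 0, fun _ _ => 0,
        fun t r => -(Y t r * dr Y t r / Real.exp (2 * lam t r)), fun _ _ => 0],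
      ![fun _ _ => 0, fun _ _ => 0, fun _ _ => 0,
        fun t r => -(Y t r * dr Y t r / Real.exp (2 * lam t r))]],
    ![![fun _ _ => 0, fun _ _ => 0, fun t r => dt Y t r / Y t r, fun _ _ => 0],
      ![fun _ _ => 0, fun _ _ => 0, fun t r => dr Y t r / Y t r, fun _ _ => 0],
      ![fun t r => dt Y t r / Y t r, fun t r => dr Y t r / Y t r, fun _ _ => 0, fun _ _ => 0],
      ![fun _ _ => 0, fun _ _ => 0, fun _ _ => 0, fun _ _ => -1]],
    ![![fun _ _ => 0, fun _ _ => 0, fun _ _ => 0, fun t r => dt Y t r / Y t r],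
      ![fun _ _ => 0, fun _ _ => 0, fun _ _ => 0, fun t r => dr Y t r / Y t r],
      ![fun _ _ => 0, fun _ _ => 0, fun _ _ => 0, fun _ _ => 1],
      ![fun t r => dt Y t r / Y t r, fun t r => dr Y t r / Y t r, fun _ _ => 1, fun _ _ => 0]]]

/-- The `θ`-dependent factor of the Christoffel symbol `Γᵃ_{bc}` of `orbitMetric k lam Y`; it is
`1` where the symbol vanishes. -/
noncomputable def christoffelOrbit (k : SignType) : Fin 4 → Fin 4 → Fin 4 → ℝ → ℝ :=
  ![![![fun _ => 1, fun _ => 1, fun _ => 1, fun _ => 1],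
      ![fun _ => 1, fun _ => 1, fun _ => 1, fun _ => 1],
      ![fun _ => 1, fun _ => 1, fun _ => 1, fun _ => 1],
      ![fun _ => 1, fun _ => 1, fun _ => 1, fun θ => orbitRadius k θ ^ 2]],
    ![![fun _ => 1, fun _ => 1, fun _ => 1, fun _ => 1],
      ![fun _ => 1, fun _ => 1, fun _ => 1, fun _ => 1],
      ![fun _ => 1, fun _ => 1, fun _ => 1, fun _ => 1],
      ![fun _ => 1, fun _ => 1, fun _ => 1, fun θ => orbitRadius k θ ^ 2]],
    ![![fun _ => 1, fun _ => 1, fun _ => 1, fun _ => 1],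
      ![fun _ => 1, fun _ => 1, fun _ => 1, fun _ => 1],
      ![fun _ => 1, fun _ => 1, fun _ => 1, fun _ => 1],
      ![fun _ => 1, fun _ => 1, fun _ => 1, fun θ => orbitRadius k θ * orbitCos k θ]],
    ![![fun _ => 1, fun _ => 1, fun _ => 1, fun _ => 1],
      ![fun _ => 1, fun _ => 1, fun _ => 1, fun _ => 1],
      ![fun _ => 1, fun _ => 1, fun _ => 1, fun θ => orbitCos k θ / orbitRadius k θ],
      ![fun _ => 1, fun _ => 1, fun θ => orbitCos k θ / orbitRadius k θ, fun _ => 1]]]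

section Curvature

variable {I J : Set ℝ} {k : SignType} {lam Y : ℝ → ℝ → ℝ}

theorem orbitMetric_inv (h : IsAdmissible I J lam Y) {x : Coord} (hx : x ∈ patch k I J) :
    (orbitMetric k lam Y x)⁻¹ = Matrix.diagonal
      ![-1, (Real.exp (2 * lam (x 0) (x 1)))⁻¹, (Y (x 0) (x 1) ^ 2)⁻¹,
        (Y (x 0) (x 1) ^ 2 * orbitRadius k (x 2) ^ 2)⁻¹] := by
  have hY := (h.Y_pos _ hx.1 _ hx.2.1).ne'
  have hS := (orbitRadius_pos hx).ne'
  refine Matrix.inv_eq_right_inv ?_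
  rw [orbitMetric, Matrix.diagonal_mul_diagonal, ← Matrix.diagonal_one]
  congr 1
  ext i
  fin_cases i <;> (simp [hY]; try field_simp)

theorem dt_const (c t r : ℝ) : dt (fun _ _ => c) t r = 0 := by simp [dt]

theorem dr_const (c t r : ℝ) : dr (fun _ _ => c) t r = 0 := by simp [dr]

theorem IsAdmissible.smoothOn_lam (h : IsAdmissible I J lam Y) : SmoothOn₂ I J lam := h.smooth_lam

theorem IsAdmissible.smoothOn_Y (h : IsAdmissible I J lam Y) : SmoothOn₂ I J Y := h.smooth_Y

theorem hasDerivAt_exp_dt (hI : IsOpen I) (hJ : IsOpen J) (h : SmoothOn₂ I J lam) {t r : ℝ}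
    (ht : t ∈ I) (hr : r ∈ J) : HasDerivAt (fun s => Real.exp (2 * lam s r))
      (2 * dt lam t r * Real.exp (2 * lam t r)) t :=
  ((h.hasDerivAt_dt hI hJ ht hr).const_mul 2).exp.congr_deriv (by ring)

theorem hasDerivAt_exp_dr (hI : IsOpen I) (hJ : IsOpen J) (h : SmoothOn₂ I J lam) {t r : ℝ}
    (ht : t ∈ I) (hr : r ∈ J) : HasDerivAt (fun s => Real.exp (2 * lam t s))
      (2 * dr lam t r * Real.exp (2 * lam t r)) r :=
  ((h.hasDerivAt_dr hI hJ ht hr).const_mul 2).exp.congr_deriv (by ring)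

theorem pd_orbitMetric (hI : IsOpen I) (hJ : IsOpen J) (h : IsAdmissible I J lam Y) {x : Coord}
    (hx : x ∈ patch k I J) (i a b : Fin 4) :
    pd i (fun y => orbitMetric k lam Y y a b) x = if a = b then
      ![![0, 0, 0, 0],
        ![2 * dt lam (x 0) (x 1) * Real.exp (2 * lam (x 0) (x 1)),
          2 * dr lam (x 0) (x 1) * Real.exp (2 * lam (x 0) (x 1)), 0, 0],
        ![2 * Y (x 0) (x 1) * dt Y (x 0) (x 1), 2 * Y (x 0) (x 1) * dr Y (x 0) (x 1), 0, 0],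
        ![2 * Y (x 0) (x 1) * dt Y (x 0) (x 1) * orbitRadius k (x 2) ^ 2,
          2 * Y (x 0) (x 1) * dr Y (x 0) (x 1) * orbitRadius k (x 2) ^ 2,
          Y (x 0) (x 1) ^ 2 * (2 * orbitRadius k (x 2) * orbitCos k (x 2)), 0]] a i
      else 0 := by
  obtain ⟨h0, h1, -⟩ := hx
  have hYt : dt (fun t r => Y t r ^ 2) (x 0) (x 1) = 2 * Y (x 0) (x 1) * dt Y (x 0) (x 1) :=
    (((h.smoothOn_Y.hasDerivAt_dt hI hJ h0 h1).pow 2).congr_deriv (by norm_num)).deriv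
  have hYr : dr (fun t r => Y t r ^ 2) (x 0) (x 1) = 2 * Y (x 0) (x 1) * dr Y (x 0) (x 1) :=
    (((h.smoothOn_Y.hasDerivAt_dr hI hJ h0 h1).pow 2).congr_deriv (by norm_num)).deriv
  have hLt : dt (fun t r => Real.exp (2 * lam t r)) (x 0) (x 1) =
      2 * dt lam (x 0) (x 1) * Real.exp (2 * lam (x 0) (x 1)) :=
    (hasDerivAt_exp_dt hI hJ h.smoothOn_lam h0 h1).deriv
  have hLr : dr (fun t r => Real.exp (2 * lam t r)) (x 0) (x 1) =
      2 * dr lam (x 0) (x 1) * Real.exp (2 * lam (x 0) (x 1)) :=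
    (hasDerivAt_exp_dr hI hJ h.smoothOn_lam h0 h1).deriv
  have hS : deriv (fun θ => orbitRadius k θ ^ 2) (x 2) =
      2 * orbitRadius k (x 2) * orbitCos k (x 2) :=
    (((hasDerivAt_orbitRadius k (x 2)).pow 2).congr_deriv (by norm_num)).deriv
  rcases eq_or_ne a b with rfl | hab
  · rw [if_pos rfl]
    fin_cases a
    · simpa [orbitMetric, dt_const, dr_const] using pd_prod (fun _ _ => -1) (fun _ => 1) i x
    · simpa [orbitMetric, hLt, hLr] using
        pd_prod (fun t r => Real.exp (2 * lam t r)) (fun _ => 1) i x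
    · have := pd_prod (fun t r => Y t r ^ 2) (fun _ => 1) i x
      rw [hYt, hYr] at this
      simpa [orbitMetric] using this
    · have := pd_prod (fun t r => Y t r ^ 2) (fun θ => orbitRadius k θ ^ 2) i x
      rw [hYt, hYr, hS] at this
      simpa [orbitMetric] using this
  · simp [orbitMetric, hab, pd]

theorem christoffel_orbitMetric (hI : IsOpen I) (hJ : IsOpen J) (h : IsAdmissible I J lam Y)
    {x : Coord} (hx : x ∈ patch k I J) (a b c : Fin 4) :
    christoffel (orbitMetric k lam Y) a b c x =
      christoffelBase lam Y a b c (x 0) (x 1) * christoffelOrbit k a b c (x 2) := by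
  have hY := (h.Y_pos _ hx.1 _ hx.2.1).ne'
  have hS := (orbitRadius_pos hx).ne'
  simp only [christoffel, orbitMetric_inv h hx, pd_orbitMetric hI hJ h hx, Fin.sum_univ_four]
  fin_cases a <;> fin_cases b <;> fin_cases c <;>
    simp [christoffelBase, christoffelOrbit] <;> field_simp

theorem pd_christoffel_orbitMetric (hI : IsOpen I) (hJ : IsOpen J) (h : IsAdmissible I J lam Y)
    {x : Coord} (hx : x ∈ patch k I J) (i a b c : Fin 4) :
    pd i (christoffel (orbitMetric k lam Y) a b c) x =
      ![dt (christoffelBase lam Y a b c) (x 0) (x 1) * christoffelOrbit k a b c (x 2),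
        dr (christoffelBase lam Y a b c) (x 0) (x 1) * christoffelOrbit k a b c (x 2),
        christoffelBase lam Y a b c (x 0) (x 1) * deriv (christoffelOrbit k a b c) (x 2), 0] i := by
  rw [pd_congr (isOpen_patch k hI hJ)
    (fun y hy => christoffel_orbitMetric hI hJ h hy a b c) hx, pd_prod]

/-- The Ricci tensor of `orbitMetric k lam Y`, apart from the factor `S(θ)²` of its last
component. The mixed derivative of `Y` is written as `dr (dt Y)` throughout. -/
noncomputable def ricciBase (k : SignType) (lam Y : ℝ → ℝ → ℝ) (t r : ℝ) :
    Matrix (Fin 4) (Fin 4) ℝ :=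
  !![-(dt (dt lam) t r + dt lam t r ^ 2) - 2 * dt (dt Y) t r / Y t r,
      -2 * (dr (dt Y) t r - dt lam t r * dr Y t r) / Y t r, 0, 0;
    -2 * (dr (dt Y) t r - dt lam t r * dr Y t r) / Y t r,
      Real.exp (2 * lam t r) *
          (dt (dt lam) t r + dt lam t r ^ 2 + 2 * dt lam t r * dt Y t r / Y t r)
        - 2 * (dr (dr Y) t r - dr lam t r * dr Y t r) / Y t r, 0, 0;
    0, 0, (k : ℝ) + Y t r * dt (dt Y) t r + dt Y t r ^ 2 + dt lam t r * Y t r * dt Y t r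
        - (Y t r * dr (dr Y) t r + dr Y t r ^ 2 - dr lam t r * Y t r * dr Y t r)
          / Real.exp (2 * lam t r), 0;
    0, 0, 0, (k : ℝ) + Y t r * dt (dt Y) t r + dt Y t r ^ 2 + dt lam t r * Y t r * dt Y t r
        - (Y t r * dr (dr Y) t r + dr Y t r ^ 2 - dr lam t r * Y t r * dr Y t r)
          / Real.exp (2 * lam t r)]

theorem ricci_orbitMetric (hI : IsOpen I) (hJ : IsOpen J) (h : IsAdmissible I J lam Y)
    {x : Coord} (hx : x ∈ patch k I J) (b c : Fin 4) :
    ricci (orbitMetric k lam Y) b c x =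
      ricciBase k lam Y (x 0) (x 1) b c * ![1, 1, 1, orbitRadius k (x 2) ^ 2] b := by
  have hS := (orbitRadius_pos hx).ne'
  obtain ⟨h0, h1, -⟩ := id hx
  have hY := (h.Y_pos _ h0 _ h1).ne'
  have hE := (Real.exp_pos (2 * lam (x 0) (x 1))).ne'
  have L := h.smoothOn_lam
  have V := h.smoothOn_Y
  have Vt := V.hasDerivAt_dt hI hJ h0 h1
  have Vr := V.hasDerivAt_dr hI hJ h0 h1
  have Et := hasDerivAt_exp_dt hI hJ L h0 h1
  have Er := hasDerivAt_exp_dr hI hJ L h0 h1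
  have Ltt := (L.dt_smooth hI hJ).hasDerivAt_dt hI hJ h0 h1
  have Vtt := (V.dt_smooth hI hJ).hasDerivAt_dt hI hJ h0 h1
  have Vrt := (V.dr_smooth hI hJ).hasDerivAt_dt hI hJ h0 h1
  have Vtr := (V.dt_smooth hI hJ).hasDerivAt_dr hI hJ h0 h1
  have Vrr := (V.dr_smooth hI hJ).hasDerivAt_dr hI hJ h0 h1
  rw [V.dt_dr hI hJ h0 h1] at Vrt
  -- the derivatives of the Christoffel symbols, left as the product and quotient rules give them
  have e1 : dt (fun t r => Real.exp (2 * lam t r) * dt lam t r) (x 0) (x 1) = _ :=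
    (Et.mul Ltt).deriv
  have e2 : dt (fun t r => Y t r * dt Y t r) (x 0) (x 1) = _ := (Vt.mul Vtt).deriv
  have e3 : dt (fun t r => dt Y t r / Y t r) (x 0) (x 1) = _ := (Vtt.div Vt hY).deriv
  have e4 : dr (fun t r => dt Y t r / Y t r) (x 0) (x 1) = _ := (Vtr.div Vr hY).deriv
  have e5 : dt (fun t r => dr Y t r / Y t r) (x 0) (x 1) = _ := (Vrt.div Vt hY).deriv
  have e6 : dr (fun t r => dr Y t r / Y t r) (x 0) (x 1) = _ := (Vrr.div Vr hY).deriv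
  have e7 : dr (fun t r => -(Y t r * dr Y t r / Real.exp (2 * lam t r))) (x 0) (x 1) = _ :=
    (((Vr.mul Vrr).div Er hE).neg).deriv
  have e8 : dt (fun t r => dt lam t r) (x 0) (x 1) = _ := Ltt.deriv
  have e9 : dr (fun t r => dt lam t r) (x 0) (x 1) = _ :=
    ((L.dt_smooth hI hJ).hasDerivAt_dr hI hJ h0 h1).deriv
  have e10 : dt (fun t r => dr lam t r) (x 0) (x 1) = _ := L.dt_dr hI hJ h0 h1
  have dS := hasDerivAt_orbitRadius k (x 2)
  have dC := hasDerivAt_orbitCos k (x 2)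
  have s1 : deriv (fun θ => orbitRadius k θ * orbitCos k θ) (x 2) = _ := (dS.mul dC).deriv
  have s2 : deriv (fun θ => orbitCos k θ / orbitRadius k θ) (x 2) = _ := (dC.div dS hS).deriv
  simp only [ricci, Fin.sum_univ_four, pd_christoffel_orbitMetric hI hJ h hx,
    christoffel_orbitMetric hI hJ h hx]
  fin_cases b <;> fin_cases c <;>
    simp [christoffelBase, christoffelOrbit, ricciBase, dt_const, dr_const, -mul_eq_zero] <;>
    (try simp only [e1, e2, e3, e4, e5, e6, e7, e8, e9, e10, s1, s2, Pi.mul_apply]) <;>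
    (try field_simp) <;> ring

/-- The Einstein tensor of `orbitMetric k lam Y`, apart from the factor `S(θ)²` of its last
component. -/
noncomputable def einsteinBase (k : SignType) (lam Y : ℝ → ℝ → ℝ) (t r : ℝ) :
    Matrix (Fin 4) (Fin 4) ℝ :=
  !![((k : ℝ) + dt Y t r ^ 2) / Y t r ^ 2 + 2 * dt lam t r * dt Y t r / Y t r
      - (2 * Y t r * dr (dr Y) t r + dr Y t r ^ 2 - 2 * dr lam t r * Y t r * dr Y t r)
        / (Y t r ^ 2 * Real.exp (2 * lam t r)),
      -2 * (dr (dt Y) t r - dt lam t r * dr Y t r) / Y t r, 0, 0;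
    -2 * (dr (dt Y) t r - dt lam t r * dr Y t r) / Y t r,
      -Real.exp (2 * lam t r) *
          (2 * dt (dt Y) t r / Y t r + ((k : ℝ) + dt Y t r ^ 2) / Y t r ^ 2)
        + dr Y t r ^ 2 / Y t r ^ 2, 0, 0;
    0, 0, -Y t r ^ 2 * (dt (dt Y) t r / Y t r + dt (dt lam) t r + dt lam t r ^ 2
          + dt lam t r * dt Y t r / Y t r)
        + Y t r * (dr (dr Y) t r - dr lam t r * dr Y t r) / Real.exp (2 * lam t r), 0;
    0, 0, 0, -Y t r ^ 2 * (dt (dt Y) t r / Y t r + dt (dt lam) t r + dt lam t r ^ 2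
          + dt lam t r * dt Y t r / Y t r)
        + Y t r * (dr (dr Y) t r - dr lam t r * dr Y t r) / Real.exp (2 * lam t r)]

theorem einstein_orbitMetric (hI : IsOpen I) (hJ : IsOpen J) (h : IsAdmissible I J lam Y)
    {x : Coord} (hx : x ∈ patch k I J) (b c : Fin 4) :
    einstein (orbitMetric k lam Y) b c x =
      einsteinBase k lam Y (x 0) (x 1) b c * ![1, 1, 1, orbitRadius k (x 2) ^ 2] b := by
  have hS := (orbitRadius_pos hx).ne'
  have hY := (h.Y_pos _ hx.1 _ hx.2.1).ne'
  have hE := (Real.exp_pos (2 * lam (x 0) (x 1))).ne'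
  simp only [einstein, scalarCurvature, orbitMetric_inv h hx, ricci_orbitMetric hI hJ h hx,
    Fin.sum_univ_four]
  fin_cases b <;> fin_cases c <;>
    simp [ricciBase, einsteinBase, orbitMetric, -mul_eq_zero] <;> field_simp <;> ring

/-- The divergence of `n ∂_t`, where `n` is arbitrary. -/
theorem divergence_comoving (hI : IsOpen I) (hJ : IsOpen J) (h : IsAdmissible I J lam Y)
    {x : Coord} (hx : x ∈ patch k I J) (n : Coord → ℝ) :
    divergence (orbitMetric k lam Y) (fun y a => n y * comoving y a) x =
      pd 0 n x + n x * (dt lam (x 0) (x 1) + 2 * dt Y (x 0) (x 1) / Y (x 0) (x 1)) := by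
  simp only [divergence, Fin.sum_univ_four, christoffel_orbitMetric hI hJ h hx]
  simp [christoffelBase, christoffelOrbit, comoving, pd]
  ring

end Curvature

/-! ### The reduced field equations -/

/-- The Einstein equations for the metric `orbitMetric k lam Y` and a comoving perfect fluid of
pressure `P` and energy density `N + P / (γ - 1)`, together with the conservation of the matter
density `N`, as equations on the `(t, r)`-domain `I × J`. -/
structure ReducedSystem (I J : Set ℝ) (k γ : ℝ) (lam Y P N : ℝ → ℝ → ℝ) : Prop where
  isOpen_left : IsOpen I
  isOpen_right : IsOpen J
  one_lt : 1 < γ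
  lam_smooth : SmoothOn₂ I J lam
  Y_smooth : SmoothOn₂ I J Y
  P_smooth : SmoothOn₂ I J P
  N_smooth : SmoothOn₂ I J N
  Y_pos : ∀ t ∈ I, ∀ r ∈ J, 0 < Y t r
  P_pos : ∀ t ∈ I, ∀ r ∈ J, 0 < P t r
  dr_Y_ne : ∀ t ∈ I, ∀ r ∈ J, dr Y t r ≠ 0
  eq_tt : ∀ t ∈ I, ∀ r ∈ J, (N t r + P t r / (γ - 1)) * Y t r ^ 2 =
    k + dt Y t r ^ 2 + 2 * Y t r * dt lam t r * dt Y t r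
      - (2 * Y t r * dr (dr Y) t r + dr Y t r ^ 2 - 2 * dr lam t r * Y t r * dr Y t r)
        / Real.exp (2 * lam t r)
  eq_tr : ∀ t ∈ I, ∀ r ∈ J, dr (dt Y) t r = dt lam t r * dr Y t r
  eq_rr : ∀ t ∈ I, ∀ r ∈ J, P t r * Y t r ^ 2 =
    -(2 * Y t r * dt (dt Y) t r + k + dt Y t r ^ 2) + dr Y t r ^ 2 / Real.exp (2 * lam t r)
  eq_angular : ∀ t ∈ I, ∀ r ∈ J, P t r * Y t r =
    -(dt (dt Y) t r + Y t r * (dt (dt lam) t r + dt lam t r ^ 2) + dt lam t r * dt Y t r)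
      + (dr (dr Y) t r - dr lam t r * dr Y t r) / Real.exp (2 * lam t r)
  matter : ∀ t ∈ I, ∀ r ∈ J, dt N t r = -N t r * (dt lam t r + 2 * dt Y t r / Y t r)

/-- The square `e^{-2λ} Y'²` of the derivative of `Y` per unit radial length. -/
noncomputable def radialSlope (lam Y : ℝ → ℝ → ℝ) : ℝ → ℝ → ℝ :=
  fun t r => dr Y t r ^ 2 / Real.exp (2 * lam t r)

/-- The expansion of the congruence of fluid lines. -/
noncomputable def expansion (lam Y : ℝ → ℝ → ℝ) : ℝ → ℝ → ℝ :=
  fun t r => dt lam t r + 2 * dt Y t r / Y t r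

/-- The difference `Ẏ / Y - λ̇` of the expansion rates along and across the orbits, which is the
shear of the congruence of fluid lines up to a constant factor, multiplied by `Y³`. -/
noncomputable def shear (lam Y : ℝ → ℝ → ℝ) : ℝ → ℝ → ℝ :=
  fun t r => Y t r ^ 2 * dt Y t r - Y t r ^ 3 * dt lam t r

/-- Twice the Misner–Sharp mass function, for orbits of curvature `k`. -/
noncomputable def massFunction (k : ℝ) (lam Y : ℝ → ℝ → ℝ) : ℝ → ℝ → ℝ :=
  fun t r => Y t r * (k + dt Y t r ^ 2 - radialSlope lam Y t r)

namespace ReducedSystem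

variable {I J : Set ℝ} {k γ : ℝ} {lam Y P N : ℝ → ℝ → ℝ} {t r : ℝ}

/-- `radialSlope` is independent of `t`: this is the `tr` equation. -/
theorem hasDerivAt_radialSlope_dt (h : ReducedSystem I J k γ lam Y P N) (ht : t ∈ I)
    (hr : r ∈ J) : HasDerivAt (fun s => radialSlope lam Y s r) 0 t := by
  have hI := h.isOpen_left
  have hJ := h.isOpen_right
  have hE := (Real.exp_pos (2 * lam t r)).ne'
  have Vrt := (h.Y_smooth.dr_smooth hI hJ).hasDerivAt_dt hI hJ ht hr
  rw [h.Y_smooth.dt_dr hI hJ ht hr, h.eq_tr t ht r hr] at Vrt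
  refine ((Vrt.pow 2).div (hasDerivAt_exp_dt hI hJ h.lam_smooth ht hr) hE).congr_deriv ?_
  simp only [Pi.pow_apply]
  field_simp
  ring

theorem hasDerivAt_radialSlope_dr (h : ReducedSystem I J k γ lam Y P N) (ht : t ∈ I)
    (hr : r ∈ J) : HasDerivAt (fun s => radialSlope lam Y t s)
      (2 * dr Y t r * (dr (dr Y) t r - dr lam t r * dr Y t r) / Real.exp (2 * lam t r)) r := by
  have hI := h.isOpen_left
  have hJ := h.isOpen_right
  have hE := (Real.exp_pos (2 * lam t r)).ne'
  have Vrr := (h.Y_smooth.dr_smooth hI hJ).hasDerivAt_dr hI hJ ht hr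
  refine ((Vrr.pow 2).div (hasDerivAt_exp_dr hI hJ h.lam_smooth ht hr) hE).congr_deriv ?_
  simp only [Pi.pow_apply]
  field_simp
  ring

/-- The pressure is spatially homogeneous, because the fluid moves on geodesics. In terms of the
field equations: the `r`-derivative of the `rr` equation agrees, up to `p' Y²`, with a multiple of
the angular equation. -/
theorem dr_P (h : ReducedSystem I J k γ lam Y P N) (ht : t ∈ I) (hr : r ∈ J) : dr P t r = 0 := by
  have hI := h.isOpen_left
  have hJ := h.isOpen_right
  have hY := (h.Y_pos t ht r hr).ne'
  have V := h.Y_smooth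
  have Vr := V.hasDerivAt_dr hI hJ ht hr
  have Pr := h.P_smooth.hasDerivAt_dr hI hJ ht hr
  have Vtr := (V.dt_smooth hI hJ).hasDerivAt_dr hI hJ ht hr
  have Vttr := ((V.dt_smooth hI hJ).dt_smooth hI hJ).hasDerivAt_dr hI hJ ht hr
  have key : dr (dt (dt Y)) t r = (dt (dt lam) t r + dt lam t r ^ 2) * dr Y t r := by
    rw [← (V.dt_smooth hI hJ).dt_dr hI hJ ht hr, dt_congr hI h.eq_tr ht hr]
    have Vrt := (V.dr_smooth hI hJ).hasDerivAt_dt hI hJ ht hr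
    rw [V.dt_dr hI hJ ht hr, h.eq_tr t ht r hr] at Vrt
    exact ((((h.lam_smooth.dt_smooth hI hJ).hasDerivAt_dt hI hJ ht hr).mul Vrt).congr_deriv
      (by ring)).deriv
  have e : dr (fun t r => P t r * Y t r ^ 2) t r = _ := (Pr.mul (Vr.pow 2)).deriv
  have e' := (((((Vr.const_mul 2).mul Vttr).add_const k).add (Vtr.pow 2)).neg.add
    (h.hasDerivAt_radialSlope_dr ht hr)).deriv
  rw [dr_congr hJ h.eq_rr ht hr] at e
  have e2 := e.symm.trans e'
  simp only [Pi.pow_apply, key, h.eq_tr t ht r hr] at e2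
  have h2 := h.eq_angular t ht r hr
  have : dr P t r * Y t r ^ 2 = 0 := by
    push_cast at e2
    linear_combination e2 - 2 * dr Y t r * h2
  simpa [hY] using this

theorem radialSlope_smooth (h : ReducedSystem I J k γ lam Y P N) :
    SmoothOn₂ I J (radialSlope lam Y) :=
  ((h.Y_smooth.dr_smooth h.isOpen_left h.isOpen_right).pow 2).div
    (contDiffOn_const.mul h.lam_smooth).exp fun _ _ => (Real.exp_pos _).ne'

theorem expansion_smooth (h : ReducedSystem I J k γ lam Y P N) :
    SmoothOn₂ I J (expansion lam Y) :=
  (h.lam_smooth.dt_smooth h.isOpen_left h.isOpen_right).add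
    ((contDiffOn_const.mul (h.Y_smooth.dt_smooth h.isOpen_left h.isOpen_right)).div h.Y_smooth
      fun q hq => (h.Y_pos q.1 hq.1 q.2 hq.2).ne')

theorem shear_smooth (h : ReducedSystem I J k γ lam Y P N) : SmoothOn₂ I J (shear lam Y) :=
  ((h.Y_smooth.pow 2).mul (h.Y_smooth.dt_smooth h.isOpen_left h.isOpen_right)).sub
    ((h.Y_smooth.pow 3).mul (h.lam_smooth.dt_smooth h.isOpen_left h.isOpen_right))

theorem massFunction_smooth (h : ReducedSystem I J k γ lam Y P N) :
    SmoothOn₂ I J (massFunction k lam Y) :=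
  h.Y_smooth.mul ((contDiffOn_const.add
    ((h.Y_smooth.dt_smooth h.isOpen_left h.isOpen_right).pow 2)).sub h.radialSlope_smooth)

theorem dt_massFunction (h : ReducedSystem I J k γ lam Y P N) (ht : t ∈ I) (hr : r ∈ J) :
    dt (massFunction k lam Y) t r = -(P t r * Y t r ^ 2 * dt Y t r) := by
  have hI := h.isOpen_left
  have hJ := h.isOpen_right
  have Vt := h.Y_smooth.hasDerivAt_dt hI hJ ht hr
  have Vtt := (h.Y_smooth.dt_smooth hI hJ).hasDerivAt_dt hI hJ ht hr
  have e := (Vt.mul (((Vtt.pow 2).const_add k).sub (h.hasDerivAt_radialSlope_dt ht hr))).deriv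
  refine Eq.trans e ?_
  have h1 := h.eq_rr t ht r hr
  simp only [Pi.pow_apply, Pi.sub_apply, radialSlope]
  push_cast
  linear_combination dt Y t r * h1

theorem dr_massFunction (h : ReducedSystem I J k γ lam Y P N) (ht : t ∈ I) (hr : r ∈ J) :
    dr (massFunction k lam Y) t r = (N t r + P t r / (γ - 1)) * Y t r ^ 2 * dr Y t r := by
  have hI := h.isOpen_left
  have hJ := h.isOpen_right
  have Vr := h.Y_smooth.hasDerivAt_dr hI hJ ht hr
  have Vtr := (h.Y_smooth.dt_smooth hI hJ).hasDerivAt_dr hI hJ ht hr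
  have e := (Vr.mul (((Vtr.pow 2).const_add k).sub (h.hasDerivAt_radialSlope_dr ht hr))).deriv
  refine Eq.trans e ?_
  have h1 := h.eq_tt t ht r hr
  simp only [Pi.pow_apply, Pi.sub_apply, radialSlope, h.eq_tr t ht r hr]
  push_cast
  linear_combination -dr Y t r * h1

/-- Conservation of energy along the fluid lines. It is the integrability condition
`∂ₜ∂ᵣm = ∂ᵣ∂ₜm` of the mass function `m`. -/
theorem energy_conservation (h : ReducedSystem I J k γ lam Y P N) (ht : t ∈ I) (hr : r ∈ J) :
    dt N t r + dt P t r / (γ - 1) =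
      -(N t r + P t r / (γ - 1) + P t r) * expansion lam Y t r := by
  have hI := h.isOpen_left
  have hJ := h.isOpen_right
  have hY := (h.Y_pos t ht r hr).ne'
  have Vt := h.Y_smooth.hasDerivAt_dt hI hJ ht hr
  have Vr := h.Y_smooth.hasDerivAt_dr hI hJ ht hr
  have Vtr := (h.Y_smooth.dt_smooth hI hJ).hasDerivAt_dr hI hJ ht hr
  have Vrt := (h.Y_smooth.dr_smooth hI hJ).hasDerivAt_dt hI hJ ht hr
  rw [h.Y_smooth.dt_dr hI hJ ht hr] at Vrt
  have Pt := h.P_smooth.hasDerivAt_dt hI hJ ht hr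
  have Pr := h.P_smooth.hasDerivAt_dr hI hJ ht hr
  have Nt := h.N_smooth.hasDerivAt_dt hI hJ ht hr
  have e := h.massFunction_smooth.dt_dr hI hJ ht hr
  rw [dt_congr hI (fun _ a _ b => h.dr_massFunction a b) ht hr,
    dr_congr hJ (fun _ a _ b => h.dt_massFunction a b) ht hr] at e
  have e1 := (((Nt.add (Pt.div_const (γ - 1))).mul (Vt.pow 2)).mul Vrt).deriv
  have e2 := (((Pr.mul (Vr.pow 2)).mul Vtr).neg).deriv
  have e3 := e1.symm.trans (Eq.trans e e2)
  simp only [Pi.pow_apply, Pi.mul_apply, Pi.add_apply, h.eq_tr t ht r hr, h.dr_P ht hr] at e3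
  push_cast at e3
  have hd := h.dr_Y_ne t ht r hr
  have : (dt N t r + dt P t r / (γ - 1) +
      (N t r + P t r / (γ - 1) + P t r) * expansion lam Y t r) * (Y t r ^ 2 * dr Y t r) = 0 := by
    rw [expansion]
    field_simp at e3 ⊢
    linear_combination Y t r * e3
  have := (mul_eq_zero.1 this).resolve_right (by positivity)
  linear_combination this

/-- The matter density drops out of the conservation of energy, by the conservation of matter. -/
theorem dt_P (h : ReducedSystem I J k γ lam Y P N) (ht : t ∈ I) (hr : r ∈ J) :
    dt P t r = -γ * P t r * expansion lam Y t r := by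
  have e := h.energy_conservation ht hr
  have hγ : γ - 1 ≠ 0 := (sub_pos.2 h.one_lt).ne'
  rw [h.matter t ht r hr] at e
  have e' : dt P t r / (γ - 1) = -(P t r / (γ - 1) + P t r) * expansion lam Y t r := by
    rw [expansion] at e ⊢
    linear_combination e
  field_simp at e'
  linear_combination e'

/-- The expansion is spatially homogeneous, since `ṗ = -γ p H` with `p` homogeneous. -/
theorem dr_expansion (h : ReducedSystem I J k γ lam Y P N) (ht : t ∈ I) (hr : r ∈ J) :
    dr (expansion lam Y) t r = 0 := by
  have hI := h.isOpen_left
  have hJ := h.isOpen_right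
  have Pr := h.P_smooth.hasDerivAt_dr hI hJ ht hr
  have Hr := h.expansion_smooth.hasDerivAt_dr hI hJ ht hr
  have e := h.P_smooth.dt_dr hI hJ ht hr
  rw [dt_congr hI (fun _ a _ b => h.dr_P a b) ht hr, dt_const,
    dr_congr hJ (fun _ a _ b => h.dt_P a b) ht hr] at e
  have e1 := Eq.trans e ((Pr.const_mul (-γ)).mul Hr).deriv
  have hP := (h.P_pos t ht r hr).ne'
  have hγ := (zero_lt_one.trans h.one_lt).ne'
  simpa [h.dr_P ht hr, hP, hγ] using e1.symm

theorem shear_eq (h : ReducedSystem I J k γ lam Y P N) (ht : t ∈ I) (hr : r ∈ J) :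
    shear lam Y t r = 3 * Y t r ^ 2 * dt Y t r - expansion lam Y t r * Y t r ^ 3 := by
  have hY := (h.Y_pos t ht r hr).ne'
  rw [shear, expansion]
  field_simp
  ring

theorem dr_shear (h : ReducedSystem I J k γ lam Y P N) (ht : t ∈ I) (hr : r ∈ J) :
    dr (shear lam Y) t r = 0 := by
  have hI := h.isOpen_left
  have hJ := h.isOpen_right
  have hY := (h.Y_pos t ht r hr).ne'
  have Vr := h.Y_smooth.hasDerivAt_dr hI hJ ht hr
  have Vtr := (h.Y_smooth.dt_smooth hI hJ).hasDerivAt_dr hI hJ ht hr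
  have Hr := h.expansion_smooth.hasDerivAt_dr hI hJ ht hr
  rw [dr_congr hJ (fun _ a _ b => h.shear_eq a b) ht hr]
  refine Eq.trans ((((Vr.pow 2).const_mul 3).mul Vtr).sub (Hr.mul (Vr.pow 3))).deriv ?_
  simp only [Pi.pow_apply, h.dr_expansion ht hr, h.eq_tr t ht r hr]
  rw [expansion]
  push_cast
  field_simp
  ring

/-- The Raychaudhuri equation, before the split of `∇u` into expansion and shear. -/
theorem raychaudhuri (h : ReducedSystem I J k γ lam Y P N) (ht : t ∈ I) (hr : r ∈ J) :
    dt (dt lam) t r + dt lam t r ^ 2 + 2 * dt (dt Y) t r / Y t r =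
      -((N t r + P t r / (γ - 1) + 3 * P t r) / 2) := by
  have hY := (h.Y_pos t ht r hr).ne'
  have h1 := h.eq_tt t ht r hr
  have h2 := h.eq_rr t ht r hr
  have h3 := h.eq_angular t ht r hr
  have e : (dt (dt lam) t r + dt lam t r ^ 2 + 2 * dt (dt Y) t r / Y t r) * Y t r ^ 2 =
      -((N t r + P t r / (γ - 1) + 3 * P t r) / 2) * Y t r ^ 2 := by
    have : 2 * dt (dt Y) t r / Y t r * Y t r ^ 2 = 2 * dt (dt Y) t r * Y t r := by
      field_simp
    linear_combination this + 1 / 2 * h1 + 1 / 2 * h2 + Y t r * h3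
  exact mul_right_cancel₀ (by positivity) e

theorem dt_expansion (h : ReducedSystem I J k γ lam Y P N) (ht : t ∈ I) (hr : r ∈ J) :
    dt (expansion lam Y) t r =
      dt (dt lam) t r + 2 * dt (dt Y) t r / Y t r - 2 * dt Y t r ^ 2 / Y t r ^ 2 := by
  have hI := h.isOpen_left
  have hJ := h.isOpen_right
  have hY := (h.Y_pos t ht r hr).ne'
  have Vt := h.Y_smooth.hasDerivAt_dt hI hJ ht hr
  have Vtt := (h.Y_smooth.dt_smooth hI hJ).hasDerivAt_dt hI hJ ht hr
  have Ltt := (h.lam_smooth.dt_smooth hI hJ).hasDerivAt_dt hI hJ ht hr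
  refine Eq.trans (Ltt.add ((Vtt.const_mul 2).div Vt hY)).deriv ?_
  field_simp
  ring

/-- The matter density, as determined by the homogeneous quantities and the shear. -/
theorem matter_density_eq (h : ReducedSystem I J k γ lam Y P N) (ht : t ∈ I) (hr : r ∈ J) :
    N t r = -2 * dt (expansion lam Y) t r - 2 / 3 * expansion lam Y t r ^ 2
      - 4 / 3 * (shear lam Y t r ^ 2 / Y t r ^ 6) - (1 / (γ - 1) + 3) * P t r := by
  have hY := (h.Y_pos t ht r hr).ne'
  have e := h.raychaudhuri ht hr
  rw [h.dt_expansion ht hr, expansion, shear]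
  have e1 : (Y t r ^ 2 * dt Y t r - Y t r ^ 3 * dt lam t r) ^ 2 / Y t r ^ 6 =
      (dt Y t r / Y t r - dt lam t r) ^ 2 := by
    field_simp
  rw [e1]
  linear_combination 2 * e

/-- In the formula for the matter density only `Y` depends on `r`. -/
theorem dr_N (h : ReducedSystem I J k γ lam Y P N) (ht : t ∈ I) (hr : r ∈ J) :
    dr N t r = 8 * shear lam Y t r ^ 2 * dr Y t r / Y t r ^ 7 := by
  have hI := h.isOpen_left
  have hJ := h.isOpen_right
  have hY := (h.Y_pos t ht r hr).ne'
  have Vr := h.Y_smooth.hasDerivAt_dr hI hJ ht hr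
  have Hr := h.expansion_smooth.hasDerivAt_dr hI hJ ht hr
  have Htr := (h.expansion_smooth.dt_smooth hI hJ).hasDerivAt_dr hI hJ ht hr
  have Cr := h.shear_smooth.hasDerivAt_dr hI hJ ht hr
  have Pr := h.P_smooth.hasDerivAt_dr hI hJ ht hr
  rw [h.dr_expansion ht hr] at Hr
  rw [h.dr_shear ht hr] at Cr
  rw [h.dr_P ht hr] at Pr
  rw [← h.expansion_smooth.dt_dr hI hJ ht hr,
    dt_congr hI (fun _ a _ b => h.dr_expansion a b) ht hr, dt_const] at Htr
  rw [dr_congr hJ (fun _ a _ b => h.matter_density_eq a b) ht hr]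
  refine Eq.trans ((((Htr.const_mul (-2)).sub ((Hr.pow 2).const_mul (2 / 3))).sub
    (((Cr.pow 2).div (Vr.pow 6) (by simpa using hY)).const_mul (4 / 3))).sub
    (Pr.const_mul (1 / (γ - 1) + 3))).deriv ?_
  simp only [Pi.pow_apply]
  push_cast
  field_simp
  ring

/-- The condition that the `r`-derivative of the matter density, computed from the shear, agrees
with the conservation of matter. -/
theorem shear_evolution (h : ReducedSystem I J k γ lam Y P N) (ht : t ∈ I) (hr : r ∈ J) :
    2 * shear lam Y t r * dt (shear lam Y) t r - shear lam Y t r ^ 2 * expansion lam Y t r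
      - 3 * (shear lam Y t r ^ 3 / Y t r ^ 3) = 0 := by
  have hI := h.isOpen_left
  have hJ := h.isOpen_right
  have hY := (h.Y_pos t ht r hr).ne'
  have hd := h.dr_Y_ne t ht r hr
  have Vt := h.Y_smooth.hasDerivAt_dt hI hJ ht hr
  have Vrt := (h.Y_smooth.dr_smooth hI hJ).hasDerivAt_dt hI hJ ht hr
  rw [h.Y_smooth.dt_dr hI hJ ht hr, h.eq_tr t ht r hr] at Vrt
  have Ct := h.shear_smooth.hasDerivAt_dt hI hJ ht hr
  have Nr := h.N_smooth.hasDerivAt_dr hI hJ ht hr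
  have Hr := h.expansion_smooth.hasDerivAt_dr hI hJ ht hr
  rw [h.dr_expansion ht hr] at Hr
  have e := h.N_smooth.dt_dr hI hJ ht hr
  rw [dt_congr hI (fun _ a _ b => h.dr_N a b) ht hr, dr_congr hJ h.matter ht hr] at e
  -- the two sides of `∂ₜ∂ᵣn = ∂ᵣ∂ₜn`
  have e1 := ((((Ct.pow 2).const_mul 8).mul Vrt).div (Vt.pow 7) (by simpa using hY)).deriv
  have e2 := (Nr.neg.mul Hr).deriv
  have e3 := e1.symm.trans (Eq.trans e e2)
  simp only [Pi.pow_apply, Pi.mul_apply, h.dr_N ht hr] at e3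
  push_cast at e3
  have s := h.shear_eq ht hr
  have x : expansion lam Y t r = dt lam t r + 2 * dt Y t r / Y t r := rfl
  have e4 : (2 * shear lam Y t r * dt (shear lam Y) t r + shear lam Y t r ^ 2 * (dt lam t r +
      expansion lam Y t r - 7 * (dt Y t r / Y t r))) * (8 * dr Y t r / Y t r ^ 7) = 0 := by
    field_simp at e3 ⊢
    linear_combination e3
  have e5 := (mul_eq_zero.1 e4).resolve_right (by positivity)
  have e6 : shear lam Y t r ^ 3 / Y t r ^ 3 = shear lam Y t r ^ 2 *
      (3 * (dt Y t r / Y t r) - expansion lam Y t r) := by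
    rw [pow_succ, s]
    field_simp
  rw [e6]
  linear_combination e5 + shear lam Y t r ^ 2 * x

/-- The shear vanishes. All the quantities in `shear_evolution` except `Y` are independent of `r`,
and `Y` is not. -/
theorem shear_eq_zero (h : ReducedSystem I J k γ lam Y P N) (ht : t ∈ I) (hr : r ∈ J) :
    shear lam Y t r = 0 := by
  have hI := h.isOpen_left
  have hJ := h.isOpen_right
  have hY := (h.Y_pos t ht r hr).ne'
  have hd := h.dr_Y_ne t ht r hr
  have Vr := h.Y_smooth.hasDerivAt_dr hI hJ ht hr
  have Hr := h.expansion_smooth.hasDerivAt_dr hI hJ ht hr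
  rw [h.dr_expansion ht hr] at Hr
  have Cr := h.shear_smooth.hasDerivAt_dr hI hJ ht hr
  rw [h.dr_shear ht hr] at Cr
  have Ctr := (h.shear_smooth.dt_smooth hI hJ).hasDerivAt_dr hI hJ ht hr
  rw [← h.shear_smooth.dt_dr hI hJ ht hr,
    dt_congr hI (fun _ a _ b => h.dr_shear a b) ht hr, dt_const] at Ctr
  have e := dr_congr hJ (fun _ a _ b => h.shear_evolution a b) ht hr
  rw [dr_const] at e
  have e1 := e.symm.trans (((((Cr.const_mul 2).mul Ctr).sub ((Cr.pow 2).mul Hr)).sub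
    (((Cr.pow 3).div (Vr.pow 3) (by simpa using hY)).const_mul 3))).deriv
  simp only [Pi.pow_apply] at e1
  push_cast at e1
  have e2 : shear lam Y t r ^ 3 * (9 * dr Y t r / Y t r ^ 4) = 0 := by
    field_simp at e1 ⊢
    linear_combination -e1
  exact eq_zero_of_pow_eq_zero ((mul_eq_zero.1 e2).resolve_right (by positivity))

theorem dt_Y (h : ReducedSystem I J k γ lam Y P N) (ht : t ∈ I) (hr : r ∈ J) :
    dt Y t r = Y t r * dt lam t r := by
  have hY := (h.Y_pos t ht r hr).ne'
  have e := h.shear_eq_zero ht hr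
  rw [shear] at e
  have : (dt Y t r - Y t r * dt lam t r) * Y t r ^ 2 = 0 := by linear_combination e
  have := (mul_eq_zero.1 this).resolve_right (by positivity)
  linear_combination this

theorem dr_N_eq_zero (h : ReducedSystem I J k γ lam Y P N) (ht : t ∈ I) (hr : r ∈ J) :
    dr N t r = 0 := by
  rw [h.dr_N ht hr, h.shear_eq_zero ht hr]
  simp

theorem expansion_eq (h : ReducedSystem I J k γ lam Y P N) (ht : t ∈ I) (hr : r ∈ J) :
    expansion lam Y t r = 3 * (dt Y t r / Y t r) := by
  have hY := (h.Y_pos t ht r hr).ne'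
  rw [expansion, h.dt_Y ht hr]
  field_simp
  ring

end ReducedSystem

/-! ### Separation of variables -/

theorem SmoothOn₂.eq_of_dr_eq_zero {I J : Set ℝ} {F : ℝ → ℝ → ℝ} (hF : SmoothOn₂ I J F)
    (hI : IsOpen I) (hJ : IsOpen J) (hJ' : IsPreconnected J)
    (h : ∀ t ∈ I, ∀ r ∈ J, dr F t r = 0) {t r r' : ℝ} (ht : t ∈ I) (hr : r ∈ J) (hr' : r' ∈ J) :
    F t r = F t r' :=
  hJ.is_const_of_deriv_eq_zero hJ' (f := fun s => F t s)
    (fun _ hs => (hF.hasDerivAt_dr hI hJ ht hs).differentiableAt.differentiableWithinAt)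
    (fun s hs => h t ht s hs) hr hr'

theorem SmoothOn₂.left {I J : Set ℝ} {F : ℝ → ℝ → ℝ} (hF : SmoothOn₂ I J F) {r : ℝ}
    (hr : r ∈ J) : ContDiffOn ℝ ∞ (fun t => F t r) I :=
  ContDiffOn.comp (t := I ×ˢ J) (f := fun t => (t, r)) hF
    (contDiff_id.prodMk contDiff_const).contDiffOn (fun _ ht => ⟨ht, hr⟩)

theorem SmoothOn₂.right {I J : Set ℝ} {F : ℝ → ℝ → ℝ} (hF : SmoothOn₂ I J F) {t : ℝ}
    (ht : t ∈ I) : ContDiffOn ℝ ∞ (fun r => F t r) J :=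
  ContDiffOn.comp (t := I ×ˢ J) (f := fun r => (t, r)) hF
    (contDiff_const.prodMk contDiff_id).contDiffOn (fun _ hr => ⟨ht, hr⟩)

/-- Every real number is the product of its sign and a positive square. -/
theorem exists_sign_mul_sq (a : ℝ) : ∃ (ε : SignType) (α : ℝ), 0 < α ∧ a = ε * α ^ 2 := by
  rcases lt_trichotomy a 0 with h | h | h
  · exact ⟨-1, √(-a), Real.sqrt_pos.2 (by linarith), by rw [Real.sq_sqrt (by linarith)]; simp⟩
  · exact ⟨0, 1, one_pos, by simp [h]⟩
  · exact ⟨1, √a, Real.sqrt_pos.2 h, by rw [Real.sq_sqrt h.le]; simp⟩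

namespace ReducedSystem

variable {I J : Set ℝ} {k γ : ℝ} {lam Y P N : ℝ → ℝ → ℝ} {t r t₀ r₀ : ℝ}

theorem dt_expansion_eq (h : ReducedSystem I J k γ lam Y P N) (ht : t ∈ I) (hr : r ∈ J) :
    dt (expansion lam Y) t r =
      3 * (dt (dt Y) t r / Y t r) - 3 * (dt Y t r / Y t r) ^ 2 := by
  have hI := h.isOpen_left
  have hJ := h.isOpen_right
  have hY := (h.Y_pos t ht r hr).ne'
  rw [dt_congr hI (fun _ a _ b => h.expansion_eq a b) ht hr]
  refine Eq.trans ((((h.Y_smooth.dt_smooth hI hJ).hasDerivAt_dt hI hJ ht hr).div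
      (h.Y_smooth.hasDerivAt_dt hI hJ ht hr) hY).const_mul 3).deriv ?_
  field_simp

/-- Without shear, the area radius `Y` is a product of functions of `t` and `r`. -/
theorem Y_mul_Y (h : ReducedSystem I J k γ lam Y P N) (hI' : IsPreconnected I)
    (hJ' : IsPreconnected J) (ht : t ∈ I) (hr : r ∈ J) (ht₀ : t₀ ∈ I) (hr₀ : r₀ ∈ J) :
    Y t r * Y t₀ r₀ = Y t r₀ * Y t₀ r := by
  have hI := h.isOpen_left
  have hJ := h.isOpen_right
  have hd : ∀ s ∈ I, HasDerivAt (fun s => Y s r / Y s r₀) 0 s := by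
    intro s hs
    have h1 := (h.Y_pos s hs r hr).ne'
    have h2 := (h.Y_pos s hs r₀ hr₀).ne'
    refine ((h.Y_smooth.hasDerivAt_dt hI hJ hs hr).div (h.Y_smooth.hasDerivAt_dt hI hJ hs hr₀)
      h2).congr_deriv ?_
    have e := h.expansion_smooth.eq_of_dr_eq_zero hI hJ hJ' (fun _ a _ b => h.dr_expansion a b)
      hs hr hr₀
    rw [h.expansion_eq hs hr, h.expansion_eq hs hr₀] at e
    field_simp at e ⊢
    linear_combination e
  have e : Y t r / Y t r₀ = Y t₀ r / Y t₀ r₀ :=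
    hI.is_const_of_deriv_eq_zero hI' (f := fun s => Y s r / Y s r₀)
      (fun s hs => (hd s hs).differentiableAt.differentiableWithinAt)
      (fun s hs => (hd s hs).deriv) ht ht₀
  rw [div_eq_div_iff (h.Y_pos t ht r₀ hr₀).ne' (h.Y_pos t₀ ht₀ r₀ hr₀).ne'] at e
  linear_combination e

theorem radialSlope_eq (h : ReducedSystem I J k γ lam Y P N) (hI' : IsPreconnected I)
    (ht : t ∈ I) (hr : r ∈ J) (ht₀ : t₀ ∈ I) : radialSlope lam Y t r = radialSlope lam Y t₀ r :=
  h.isOpen_left.is_const_of_deriv_eq_zero hI' (f := fun s => radialSlope lam Y s r)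
    (fun _ hs => (h.hasDerivAt_radialSlope_dt hs hr).differentiableAt.differentiableWithinAt)
    (fun _ hs => (h.hasDerivAt_radialSlope_dt hs hr).deriv) ht ht₀

/-- `(k - F) / Y²` is independent of `r`, where `F` is `radialSlope lam Y`: the slices of constant
time have constant curvature. -/
theorem curvature_const (h : ReducedSystem I J k γ lam Y P N) (hI' : IsPreconnected I)
    (hJ' : IsPreconnected J) (ht : t ∈ I) (hr : r ∈ J) (ht₀ : t₀ ∈ I) (hr₀ : r₀ ∈ J) :
    (k - radialSlope lam Y t r) * Y t₀ r₀ ^ 2 =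
      (k - radialSlope lam Y t₀ r₀) * Y t₀ r ^ 2 := by
  have hI := h.isOpen_left
  have hJ := h.isOpen_right
  have e : ∀ s ∈ J, (k - radialSlope lam Y t₀ s) =
      -(P t₀ s + 2 * (dt (dt Y) t₀ s / Y t₀ s) + (dt Y t₀ s / Y t₀ s) ^ 2) * Y t₀ s ^ 2 := by
    intro s hs
    have := h.eq_rr t₀ ht₀ s hs
    have hY := (h.Y_pos t₀ ht₀ s hs).ne'
    rw [radialSlope]
    generalize dr Y t₀ s ^ 2 / Real.exp (2 * lam t₀ s) = q at this ⊢
    field_simp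
    linear_combination this
  have hP := h.P_smooth.eq_of_dr_eq_zero hI hJ hJ' (fun _ a _ b => h.dr_P a b) ht₀ hr hr₀
  have hH := h.expansion_smooth.eq_of_dr_eq_zero hI hJ hJ' (fun _ a _ b => h.dr_expansion a b)
    ht₀ hr hr₀
  have hHt := (h.expansion_smooth.dt_smooth hI hJ).eq_of_dr_eq_zero hI hJ hJ' (fun _ a _ b => by
    rw [← h.expansion_smooth.dt_dr hI hJ a b,
      dt_congr hI (fun _ a _ b => h.dr_expansion a b) a b, dt_const]) ht₀ hr hr₀
  have key : ∀ s ∈ J, 3 * (dt (dt Y) t₀ s / Y t₀ s) =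
      dt (expansion lam Y) t₀ s + 3 * (dt Y t₀ s / Y t₀ s) ^ 2 := by
    intro s hs
    have hY := (h.Y_pos t₀ ht₀ s hs).ne'
    rw [h.dt_expansion_eq ht₀ hs]
    ring
  rw [h.expansion_eq ht₀ hr, h.expansion_eq ht₀ hr₀] at hH
  have hH' : dt Y t₀ r / Y t₀ r = dt Y t₀ r₀ / Y t₀ r₀ := by linarith
  have k1 := key r hr
  have k2 := key r₀ hr₀
  rw [hH', hHt] at k1
  have k3 : dt (dt Y) t₀ r / Y t₀ r = dt (dt Y) t₀ r₀ / Y t₀ r₀ := by linarith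
  rw [h.radialSlope_eq hI' ht hr ht₀, e r hr, e r₀ hr₀, hP, hH', k3]
  ring

/-- Every solution of the reduced system is a Friedmann model, with the reference radius `R₀ = 1`:
the constants `n₀`, `p₀` are the values of `n R³` and `p R^{3γ}`. -/
theorem exists_model (h : ReducedSystem I J k γ lam Y P N) (hI' : IsPreconnected I)
    (hJ' : IsPreconnected J) (hI₀ : I.Nonempty) (hJ₀ : J.Nonempty)
    (hN : ∀ t ∈ I, ∀ r ∈ J, 0 < N t r) :
    ∃ (ε : SignType) (n₀ p₀ : ℝ) (R M : ℝ → ℝ), IsFLRWModel ε γ n₀ p₀ 1 I R ∧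
      ContDiffOn ℝ ∞ M J ∧ (∀ r ∈ J, 0 < M r) ∧ ∀ t ∈ I, ∀ r ∈ J,
        Y t r = R t * M r ∧ 0 < k - ε * M r ^ 2 ∧
        Real.exp (2 * lam t r) * (k - ε * M r ^ 2) = (R t * deriv M r) ^ 2 ∧
        P t r = modelPressure γ p₀ 1 (R t) ∧ N t r = modelMatter n₀ 1 (R t) := by
  have hI := h.isOpen_left
  have hJ := h.isOpen_right
  obtain ⟨t₀, ht₀⟩ := hI₀
  obtain ⟨r₀, hr₀⟩ := hJ₀
  obtain ⟨ε, α, hα, hεα⟩ := exists_sign_mul_sq (k - radialSlope lam Y t₀ r₀)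
  have hY0 := h.Y_pos t₀ ht₀ r₀ hr₀
  -- `α` rescales the curvature `k - F` at `r₀`, where `M = α`, to `ε M²` with `ε` a sign
  set R : ℝ → ℝ := fun t => Y t r₀ / α with hR
  set M : ℝ → ℝ := fun r => α * (Y t₀ r / Y t₀ r₀) with hM
  have hRpos : ∀ t ∈ I, 0 < R t := fun t ht => div_pos (h.Y_pos t ht r₀ hr₀) hα
  have hY : ∀ t ∈ I, ∀ r ∈ J, Y t r = R t * M r := by
    intro t ht r hr
    have := h.Y_mul_Y hI' hJ' ht hr ht₀ hr₀
    simp only [hR, hM]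
    field_simp
    exact this
  have hR' : deriv R = fun t => dt Y t r₀ / α := by
    ext t; simp [hR, dt]
  have hR'' : deriv (deriv R) = fun t => dt (dt Y) t r₀ / α := by
    rw [hR']; ext t; simp [dt]
  have hF : ∀ t ∈ I, ∀ r ∈ J, radialSlope lam Y t r = k - ε * M r ^ 2 := by
    intro t ht r hr
    have e := h.curvature_const hI' hJ' ht hr ht₀ hr₀
    rw [hεα] at e
    simp only [hM]
    field_simp
    linear_combination -e
  have hFpos : ∀ t ∈ I, ∀ r ∈ J, 0 < radialSlope lam Y t r := fun t ht r hr =>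
    div_pos (pow_pos (abs_pos.2 (h.dr_Y_ne t ht r hr)) 2 |>.trans_eq (sq_abs _))
      (Real.exp_pos _)
  -- `P` and `N` scale as powers of `R`
  have hPc : ∀ t ∈ I, P t r₀ * R t ^ (3 * γ) = P t₀ r₀ * R t₀ ^ (3 * γ) := by
    have hd : ∀ s ∈ I, HasDerivAt (fun s => P s r₀ * R s ^ (3 * γ)) 0 s := by
      intro s hs
      have hs0 := (hRpos s hs).ne'
      have hy := (h.Y_pos s hs r₀ hr₀).ne'
      refine ((h.P_smooth.hasDerivAt_dt hI hJ hs hr₀).mul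
        (((h.Y_smooth.hasDerivAt_dt hI hJ hs hr₀).div_const α).rpow_const
          (p := 3 * γ) (Or.inl hs0))).congr_deriv ?_
      rw [Real.rpow_sub_one hs0, h.dt_P hs hr₀, h.expansion_eq hs hr₀]
      simp only [hR]
      field_simp
      ring
    intro t ht
    exact hI.is_const_of_deriv_eq_zero hI' (f := fun s => P s r₀ * R s ^ (3 * γ))
      (fun s hs => (hd s hs).differentiableAt.differentiableWithinAt)
      (fun s hs => (hd s hs).deriv) ht ht₀
  have hNc : ∀ t ∈ I, N t r₀ * R t ^ 3 = N t₀ r₀ * R t₀ ^ 3 := by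
    have hd : ∀ s ∈ I, HasDerivAt (fun s => N s r₀ * R s ^ 3) 0 s := by
      intro s hs
      have hy := (h.Y_pos s hs r₀ hr₀).ne'
      refine ((h.N_smooth.hasDerivAt_dt hI hJ hs hr₀).mul
        (((h.Y_smooth.hasDerivAt_dt hI hJ hs hr₀).div_const α).pow 3)).congr_deriv ?_
      have e := h.expansion_eq hs hr₀
      rw [expansion] at e
      rw [h.matter s hs r₀ hr₀, e]
      simp only [Pi.pow_apply]
      push_cast
      field_simp
      ring
    intro t ht
    exact hI.is_const_of_deriv_eq_zero hI' (f := fun s => N s r₀ * R s ^ 3)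
      (fun s hs => (hd s hs).differentiableAt.differentiableWithinAt)
      (fun s hs => (hd s hs).deriv) ht ht₀
  have hPm : ∀ t ∈ I, ∀ r ∈ J,
      P t r = modelPressure γ (P t₀ r₀ * R t₀ ^ (3 * γ)) 1 (R t) := by
    intro t ht r hr
    have := (Real.rpow_pos_of_pos (hRpos t ht) (3 * γ)).ne'
    rw [h.P_smooth.eq_of_dr_eq_zero hI hJ hJ' (fun _ a _ b => h.dr_P a b) ht hr hr₀,
      modelPressure, ← hPc t ht, one_div, Real.inv_rpow (hRpos t ht).le]
    field_simp
  have hNm : ∀ t ∈ I, ∀ r ∈ J, N t r = modelMatter (N t₀ r₀ * R t₀ ^ 3) 1 (R t) := by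
    intro t ht r hr
    have := (hRpos t ht).ne'
    rw [h.N_smooth.eq_of_dr_eq_zero hI hJ hJ' (fun _ a _ b => h.dr_N_eq_zero a b) ht hr hr₀,
      modelMatter, ← hNc t ht]
    field_simp
  have hMr₀ : M r₀ = α := by simp only [hM]; field_simp
  have hpress : ∀ t ∈ I, -(2 * deriv (deriv R) t / R t) - deriv R t ^ 2 / R t ^ 2
      - (ε : ℝ) / R t ^ 2 = P t r₀ := by
    intro t ht
    have hy := (h.Y_pos t ht r₀ hr₀).ne'
    have e := h.eq_rr t ht r₀ hr₀
    have f := hF t ht r₀ hr₀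
    rw [radialSlope] at f
    rw [f, hMr₀] at e
    rw [hR'', hR']
    simp only [hR]
    field_simp
    linear_combination -e
  refine ⟨ε, N t₀ r₀ * R t₀ ^ 3, P t₀ r₀ * R t₀ ^ (3 * γ), R, M, ⟨?_, ?_, one_pos, ?_, hRpos,
    ?_, ?_⟩, ?_, ?_, ?_⟩
  · exact mul_pos (hN t₀ ht₀ r₀ hr₀) (pow_pos (hRpos t₀ ht₀) 3)
  · exact mul_pos (h.P_pos t₀ ht₀ r₀ hr₀) (Real.rpow_pos_of_pos (hRpos t₀ ht₀) _)
  · exact (h.Y_smooth.left hr₀).div_const α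
  · intro t ht
    have e1 := hpress t ht
    have hy := (h.Y_pos t ht r₀ hr₀).ne'
    have hL : dt lam t r₀ = dt Y t r₀ / Y t r₀ := by rw [h.dt_Y ht hr₀]; field_simp
    have e2 := h.raychaudhuri ht hr₀
    have e3 : dt (dt lam) t r₀ + dt lam t r₀ ^ 2 = dt (dt Y) t r₀ / Y t r₀ := by
      have a := h.dt_expansion ht hr₀
      rw [h.dt_expansion_eq ht hr₀] at a
      rw [hL]
      field_simp at a ⊢
      linear_combination -a
    have e4 : deriv (deriv R) t / R t = dt (dt Y) t r₀ / Y t r₀ := by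
      rw [hR'']; simp only [hR]; field_simp
    have e5 : modelEnergy γ (N t₀ r₀ * R t₀ ^ 3) (P t₀ r₀ * R t₀ ^ (3 * γ)) 1 (R t) =
        N t r₀ + P t r₀ / (γ - 1) := by
      rw [hNm t ht r₀ hr₀, hPm t ht r₀ hr₀, modelEnergy, modelMatter, modelPressure]
      ring
    rw [e5]
    rw [e3] at e2
    linear_combination -3 * e1 - 2 * e2 - 6 * e4
  · intro t ht
    rw [hpress t ht, hPm t ht r₀ hr₀]
  · exact contDiffOn_const.mul ((h.Y_smooth.right ht₀).div_const _)
  · exact fun r hr => mul_pos hα (div_pos (h.Y_pos t₀ ht₀ r hr) hY0)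
  · intro t ht r hr
    refine ⟨hY t ht r hr, hF t ht r hr ▸ hFpos t ht r hr, ?_, hPm t ht r hr, hNm t ht r hr⟩
    have e1 : dr Y t r = R t * deriv M r := by
      rw [dr_congr hJ hY ht hr, dr, deriv_const_mul_field]
    rw [← hF t ht r hr, radialSlope, e1]
    field_simp

end ReducedSystem

/-! ### Maps into the spaces of constant curvature -/

theorem hasDerivAt_pd {D : Set Coord} (hD : IsOpen D) {f : Coord → ℝ} (hf : ContDiffOn ℝ ∞ f D)
    {x : Coord} (hx : x ∈ D) (i : Fin 4) :
    HasDerivAt (fun s : ℝ => f (Function.update x i s)) (pd i f x) (x i) := by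
  have h1 : DifferentiableAt ℝ f (Function.update x i (x i)) := by
    rw [Function.update_eq_self]
    exact (hf.contDiffAt (hD.mem_nhds hx)).differentiableAt (by simp)
  exact (h1.comp (x i) (hasDerivAt_update x i (x i)).differentiableAt).hasDerivAt

/-- Partial derivatives of a function of the spatial coordinates. -/
theorem pd_spatial (F : ℝ → ℝ → ℝ → ℝ) (i : Fin 4) (x : Coord) :
    pd i (fun y => F (y 1) (y 2) (y 3)) x =
      ![0, deriv (fun s => F s (x 2) (x 3)) (x 1), deriv (fun s => F (x 1) s (x 3)) (x 2),
        deriv (fun s => F (x 1) (x 2) s) (x 3)] i := by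
  fin_cases i <;> simp [pd]

/-- The map `(X, W)` sends the region `D` to the quadric `W² + ε |X|² = 1`, `W > -1`, on which
`|dX|² + ε dW²` has constant curvature `ε`, and `q` is the pull-back of that form. For `ε = 0` the
quadric is the hyperplane `W = 1`. -/
structure IsSpaceFormMap (ε : SignType) (D : Set Coord) (X : Fin 3 → Coord → ℝ) (W : Coord → ℝ)
    (q : Coord → Matrix (Fin 4) (Fin 4) ℝ) : Prop where
  smooth_X : ∀ a, ContDiffOn ℝ ∞ (X a) D
  smooth_W : ContDiffOn ℝ ∞ W D
  W_gt : ∀ x ∈ D, -1 < W x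
  quadric : ∀ x ∈ D, W x ^ 2 + ε * ∑ a, X a x ^ 2 = 1
  form : ∀ x ∈ D, ∀ i j,
    ∑ a, pd i (X a) x * pd j (X a) x + ε * (pd i W x * pd j W x) = q x i j

/-- The stereographic projection of `(X, W)`, with the time coordinate carried along. -/
noncomputable def stereographic (X : Fin 3 → Coord → ℝ) (W : Coord → ℝ) : Coord → Coord := fun y =>
  ![y 0, 2 * X 0 y / (1 + W y), 2 * X 1 y / (1 + W y), 2 * X 2 y / (1 + W y)]

namespace IsSpaceFormMap

variable {ε : SignType} {D : Set Coord} {X : Fin 3 → Coord → ℝ} {W : Coord → ℝ}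
  {q : Coord → Matrix (Fin 4) (Fin 4) ℝ} {x : Coord}

/-- The derivative of the equation of the quadric. -/
theorem tangent (h : IsSpaceFormMap ε D X W q) (hD : IsOpen D) (hx : x ∈ D) (i : Fin 4) :
    W x * pd i W x + ε * ∑ a, X a x * pd i (X a) x = 0 := by
  have e1 : pd i (fun y => W y ^ 2 + ε * (X 0 y ^ 2 + X 1 y ^ 2 + X 2 y ^ 2)) x = 0 := by
    rw [pd_congr hD (g := fun _ => 1) (fun y hy => ?_) hx]
    · simp [pd]
    · rw [← h.quadric y hy, Fin.sum_univ_three]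
  have d := fun a => (hasDerivAt_pd hD (h.smooth_X a) hx i).pow 2
  have e2 := (((hasDerivAt_pd hD h.smooth_W hx i).pow 2).add
    ((((d 0).add (d 1)).add (d 2)).const_mul (ε : ℝ))).deriv
  have e3 := e2.symm.trans e1
  simp only [Function.update_eq_self] at e3
  push_cast at e3
  rw [Fin.sum_univ_three]
  linear_combination e3 / 2

theorem contDiffOn_stereographic (h : IsSpaceFormMap ε D X W q) :
    ContDiffOn ℝ ∞ (stereographic X W) D := by
  have hd : ∀ a, ContDiffOn ℝ ∞ (fun y => 2 * X a y / (1 + W y)) D := fun a =>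
    (contDiffOn_const.mul (h.smooth_X a)).div (contDiffOn_const.add h.smooth_W)
      fun y hy => by linarith [h.W_gt y hy]
  refine contDiffOn_pi.2 fun a => ?_
  fin_cases a
  · exact (contDiff_apply ℝ ℝ (0 : Fin 4)).contDiffOn
  · exact hd 0
  · exact hd 1
  · exact hd 2

theorem isotropicFactor_stereographic (h : IsSpaceFormMap ε D X W q) (hx : x ∈ D) :
    isotropicFactor ε (stereographic X W x) = 2 / (1 + W x) := by
  have hW : 1 + W x ≠ 0 := by linarith [h.W_gt x hx]
  have e := h.quadric x hx
  rw [Fin.sum_univ_three] at e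
  simp [isotropicFactor, stereographic]
  field_simp
  linear_combination 4 * e

/-- The stereographic projection of the quadric carries `|dX|² + ε dW²` to the isotropic form of the
metric of constant curvature `ε`. -/
theorem pullback_stereographic (h : IsSpaceFormMap ε D X W q) (hD : IsOpen D) (hx : x ∈ D)
    (R : ℝ → ℝ) (i j : Fin 4) :
    pullback (stereographic X W) (flrwMetric ε R) x i j =
      -(pd i (fun y => y 0) x * pd j (fun y => y 0) x) + R (x 0) ^ 2 * q x i j := by
  have hW : 1 + W x ≠ 0 := by linarith [h.W_gt x hx]
  have hp : ∀ i a, pd i (fun y => 2 * X a y / (1 + W y)) x =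
      2 * (pd i (X a) x - X a x * (pd i W x / (1 + W x))) / (1 + W x) := by
    intro i a
    refine Eq.trans (((hasDerivAt_pd hD (h.smooth_X a) hx i).const_mul 2).div
      ((hasDerivAt_pd hD h.smooth_W hx i).const_add 1) (by simpa using hW)).deriv ?_
    simp only [Function.update_eq_self]
    field_simp
  have hs : pullback (stereographic X W) (flrwMetric ε R) x i j =
      -(pd i (fun y => y 0) x * pd j (fun y => y 0) x) + R (x 0) ^ 2 *
        ∑ a, (pd i (X a) x - X a x * (pd i W x / (1 + W x))) *
          (pd j (X a) x - X a x * (pd j W x / (1 + W x))) := by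
    simp only [pullback, Matrix.of_apply, Fin.sum_univ_four, Fin.sum_univ_three, flrwMetric,
      h.isotropicFactor_stereographic hx]
    simp [stereographic, hp]
    field_simp
    ring
  rw [hs, ← h.form x hx]
  have ti := h.tangent hD hx i
  have tj := h.tangent hD hx j
  have e := h.quadric x hx
  simp only [Fin.sum_univ_three] at ti tj e ⊢
  congr 2
  -- for `ε = 0` the constraint forces `dW = 0`; otherwise it determines `X · dX` and `|X|²`
  rcases eq_or_ne ε 0 with rfl | hε
  · simp only [SignType.coe_zero, zero_mul, add_zero] at ti tj e ⊢
    have hW0 : W x ≠ 0 := by intro h0; simp [h0] at e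
    simp [(mul_eq_zero.1 ti).resolve_left hW0, (mul_eq_zero.1 tj).resolve_left hW0]
  · have hε2 : (ε : ℝ) * ε = 1 := by
      cases ε
      · exact absurd rfl hε
      · simp
      · simp
    obtain ⟨u, hu⟩ : ∃ u, u = pd i W x / (1 + W x) := ⟨_, rfl⟩
    obtain ⟨v, hv⟩ : ∃ v, v = pd j W x / (1 + W x) := ⟨_, rfl⟩
    rw [← hu, ← hv]
    have hu' : pd i W x = u * (1 + W x) := by rw [hu]; field_simp
    have hv' : pd j W x = v * (1 + W x) := by rw [hv]; field_simp
    rw [hu'] at ti ⊢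
    rw [hv'] at tj ⊢
    have s1 : X 0 x * pd i (X 0) x + X 1 x * pd i (X 1) x + X 2 x * pd i (X 2) x =
        -ε * (W x * (u * (1 + W x))) := by linear_combination ε * ti - (X 0 x * pd i (X 0) x +
          X 1 x * pd i (X 1) x + X 2 x * pd i (X 2) x) * hε2
    have s2 : X 0 x * pd j (X 0) x + X 1 x * pd j (X 1) x + X 2 x * pd j (X 2) x =
        -ε * (W x * (v * (1 + W x))) := by linear_combination ε * tj - (X 0 x * pd j (X 0) x +
          X 1 x * pd j (X 1) x + X 2 x * pd j (X 2) x) * hε2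
    have s3 : X 0 x ^ 2 + X 1 x ^ 2 + X 2 x ^ 2 = ε * (1 - W x ^ 2) := by
      linear_combination ε * e - (X 0 x ^ 2 + X 1 x ^ 2 + X 2 x ^ 2) * hε2
    linear_combination -v * s1 - u * s2 + u * v * s3

end IsSpaceFormMap

/-! ### The slices of constant time as spaces of constant curvature -/

section Slices

variable {I J : Set ℝ} {M : ℝ → ℝ} {ε : SignType}

/-- The metric `M'² / (k - ε M²) dr² + M² (dθ² + S(θ)² dφ²)`. -/
noncomputable def sliceForm (k ε : SignType) (M : ℝ → ℝ) : Coord → Matrix (Fin 4) (Fin 4) ℝ :=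
  fun x => Matrix.diagonal
    ![0, deriv M (x 1) ^ 2 / (k - ε * M (x 1) ^ 2), M (x 1) ^ 2,
      M (x 1) ^ 2 * orbitRadius k (x 2) ^ 2]

theorem contDiffOn_comp_radial {k : SignType} (hM : ContDiffOn ℝ ∞ M J) :
    ContDiffOn ℝ ∞ (fun y : Coord => M (y 1)) (patch k I J) :=
  hM.comp (contDiff_apply ℝ ℝ (1 : Fin 4)).contDiffOn fun _ hy => hy.2.1

/-- Polar coordinates around a point of a space of constant curvature `ε`. -/
theorem exists_spaceFormMap_pos (hJ : IsOpen J) (hM : ContDiffOn ℝ ∞ M J)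
    (h : ∀ r ∈ J, 0 < 1 - (ε : ℝ) * M r ^ 2) :
    ∃ X W, IsSpaceFormMap ε (patch .pos I J) X W (sliceForm .pos ε M) := by
  have hM1 := contDiffOn_comp_radial (I := I) (k := .pos) hM
  have c2 : ContDiff ℝ ∞ fun y : Coord => y 2 := contDiff_apply ℝ ℝ (2 : Fin 4)
  have c3 : ContDiff ℝ ∞ fun y : Coord => y 3 := contDiff_apply ℝ ℝ (3 : Fin 4)
  refine ⟨![fun y => M (y 1) * Real.sin (y 2) * Real.cos (y 3),
    fun y => M (y 1) * Real.sin (y 2) * Real.sin (y 3), fun y => M (y 1) * Real.cos (y 2)],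
    fun y => √(1 - ε * M (y 1) ^ 2), fun a => ?_, ?_, ?_, ?_, ?_⟩
  · fin_cases a
    · exact (hM1.mul c2.sin.contDiffOn).mul c3.cos.contDiffOn
    · exact (hM1.mul c2.sin.contDiffOn).mul c3.sin.contDiffOn
    · exact hM1.mul c2.cos.contDiffOn
  · exact (contDiffOn_const.sub (contDiffOn_const.mul (hM1.pow 2))).sqrt
      fun y hy => (h _ hy.2.1).ne'
  · intro x _
    linarith [Real.sqrt_nonneg (1 - ε * M (x 1) ^ 2)]
  · intro x hx
    simp only [Real.sq_sqrt (h _ hx.2.1).le, Fin.sum_univ_three, Matrix.cons_val]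
    linear_combination ε * M (x 1) ^ 2 * Real.sin (x 2) ^ 2 * Real.sin_sq_add_cos_sq (x 3) +
      ε * M (x 1) ^ 2 * Real.sin_sq_add_cos_sq (x 2)
  · intro x hx i j
    have hp := h _ hx.2.1
    have hs := Real.sqrt_pos.2 hp
    have hd : HasDerivAt M (deriv M (x 1)) (x 1) :=
      ((hM.contDiffAt (hJ.mem_nhds hx.2.1)).differentiableAt (by simp)).hasDerivAt
    have dW : deriv (fun s => √(1 - ε * M s ^ 2)) (x 1) =
        -(ε * M (x 1) * deriv M (x 1)) / √(1 - ε * M (x 1) ^ 2) := by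
      refine Eq.trans ((((hd.pow 2).const_mul (ε : ℝ)).const_sub 1).sqrt hp.ne').deriv ?_
      simp only [Pi.pow_apply]
      field_simp
      ring
    have p0 := fun i => pd_spatial (fun r θ φ => M r * Real.sin θ * Real.cos φ) i x
    have p1 := fun i => pd_spatial (fun r θ φ => M r * Real.sin θ * Real.sin φ) i x
    have p2 := fun i => pd_spatial (fun r θ _ => M r * Real.cos θ) i x
    have p3 := fun i => pd_spatial (fun r _ _ => √(1 - ε * M r ^ 2)) i x
    simp only [Fin.sum_univ_three, Matrix.cons_val, p0, p1, p2, p3, dW]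
    have q2 := Real.sin_sq_add_cos_sq (x 2)
    have q3 := Real.sin_sq_add_cos_sq (x 3)
    have hε : (ε : ℝ) ^ 3 = ε := by cases ε <;> norm_num
    have qs : (ε : ℝ) * (-(ε * M (x 1) * deriv M (x 1)) / √(1 - ε * M (x 1) ^ 2) *
        (-(ε * M (x 1) * deriv M (x 1)) / √(1 - ε * M (x 1) ^ 2))) =
        deriv M (x 1) ^ 2 / (1 - ε * M (x 1) ^ 2) - deriv M (x 1) ^ 2 := by
      rw [div_mul_div_comm, Real.mul_self_sqrt hp.le]
      field_simp
      linear_combination M (x 1) ^ 2 * deriv M (x 1) ^ 2 * hε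
    fin_cases i <;> fin_cases j <;> simp [sliceForm, orbitRadius, -mul_eq_zero]
    · linear_combination qs + deriv M (x 1) ^ 2 * Real.sin (x 2) ^ 2 * q3 + deriv M (x 1) ^ 2 * q2
    · linear_combination M (x 1) * deriv M (x 1) * Real.sin (x 2) * Real.cos (x 2) * q3
    · ring
    · linear_combination M (x 1) * deriv M (x 1) * Real.sin (x 2) * Real.cos (x 2) * q3
    · linear_combination M (x 1) ^ 2 * Real.cos (x 2) ^ 2 * q3 + M (x 1) ^ 2 * q2
    · ring
    · ring
    · ring
    · linear_combination M (x 1) ^ 2 * Real.sin (x 2) ^ 2 * q3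

/-- Hyperbolic space, sliced by the surfaces equidistant from a plane. -/
theorem exists_spaceFormMap_neg (hJ : IsOpen J) (hM : ContDiffOn ℝ ∞ M J) (hM0 : ∀ r ∈ J, 0 < M r)
    (h : ∀ r ∈ J, 0 < -1 + M r ^ 2) :
    ∃ X W, IsSpaceFormMap (-1) (patch .neg I J) X W (sliceForm .neg (-1) M) := by
  have hM1 := contDiffOn_comp_radial (I := I) (k := .neg) hM
  have c2 : ContDiff ℝ ∞ fun y : Coord => y 2 := contDiff_apply ℝ ℝ (2 : Fin 4)
  have c3 : ContDiff ℝ ∞ fun y : Coord => y 3 := contDiff_apply ℝ ℝ (3 : Fin 4)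
  refine ⟨![fun y => M (y 1) * Real.sinh (y 2) * Real.cos (y 3),
    fun y => M (y 1) * Real.sinh (y 2) * Real.sin (y 3), fun y => √(-1 + M (y 1) ^ 2)],
    fun y => M (y 1) * Real.cosh (y 2), fun a => ?_, ?_, ?_, ?_, ?_⟩
  · fin_cases a
    · exact (hM1.mul c2.sinh.contDiffOn).mul c3.cos.contDiffOn
    · exact (hM1.mul c2.sinh.contDiffOn).mul c3.sin.contDiffOn
    · exact (contDiffOn_const.add (hM1.pow 2)).sqrt fun y hy => (h _ hy.2.1).ne'
  · exact hM1.mul c2.cosh.contDiffOn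
  · intro x hx
    linarith [mul_pos (hM0 _ hx.2.1) (Real.cosh_pos (x 2))]
  · intro x hx
    simp only [Real.sq_sqrt (h _ hx.2.1).le, Fin.sum_univ_three, Matrix.cons_val,
      SignType.coe_neg, SignType.coe_one]
    linear_combination -M (x 1) ^ 2 * Real.sinh (x 2) ^ 2 * Real.sin_sq_add_cos_sq (x 3) +
      M (x 1) ^ 2 * Real.cosh_sq (x 2)
  · intro x hx i j
    have hp := h _ hx.2.1
    have hs := Real.sqrt_pos.2 hp
    have hd : HasDerivAt M (deriv M (x 1)) (x 1) :=
      ((hM.contDiffAt (hJ.mem_nhds hx.2.1)).differentiableAt (by simp)).hasDerivAt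
    have dV : deriv (fun s => √(-1 + M s ^ 2)) (x 1) =
        M (x 1) * deriv M (x 1) / √(-1 + M (x 1) ^ 2) := by
      refine Eq.trans (((hd.pow 2).const_add (-1)).sqrt hp.ne').deriv ?_
      simp only [Pi.pow_apply]
      field_simp
      ring
    have p0 := fun i => pd_spatial (fun r θ φ => M r * Real.sinh θ * Real.cos φ) i x
    have p1 := fun i => pd_spatial (fun r θ φ => M r * Real.sinh θ * Real.sin φ) i x
    have p2 := fun i => pd_spatial (fun r _ _ => √(-1 + M r ^ 2)) i x
    have p3 := fun i => pd_spatial (fun r θ _ => M r * Real.cosh θ) i x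
    simp only [Fin.sum_univ_three, Matrix.cons_val, p0, p1, p2, p3, dV]
    have q2 := Real.cosh_sq (x 2)
    have q3 := Real.sin_sq_add_cos_sq (x 3)
    have qs : M (x 1) * deriv M (x 1) / √(-1 + M (x 1) ^ 2) *
        (M (x 1) * deriv M (x 1) / √(-1 + M (x 1) ^ 2)) =
        deriv M (x 1) ^ 2 / (-1 + M (x 1) ^ 2) + deriv M (x 1) ^ 2 := by
      rw [div_mul_div_comm, Real.mul_self_sqrt hp.le]
      field_simp
      ring
    fin_cases i <;> fin_cases j <;> simp [sliceForm, orbitRadius, -mul_eq_zero]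
    · linear_combination qs + deriv M (x 1) ^ 2 * Real.sinh (x 2) ^ 2 * q3 - deriv M (x 1) ^ 2 * q2
    · linear_combination M (x 1) * deriv M (x 1) * Real.sinh (x 2) * Real.cosh (x 2) * q3
    · ring
    · linear_combination M (x 1) * deriv M (x 1) * Real.sinh (x 2) * Real.cosh (x 2) * q3
    · linear_combination M (x 1) ^ 2 * Real.cosh (x 2) ^ 2 * q3 + M (x 1) ^ 2 * q2
    · ring
    · ring
    · ring
    · linear_combination M (x 1) ^ 2 * Real.sinh (x 2) ^ 2 * q3

/-- Hyperbolic space in horospherical coordinates. -/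
theorem exists_spaceFormMap_zero (hJ : IsOpen J) (hM : ContDiffOn ℝ ∞ M J)
    (hM0 : ∀ r ∈ J, 0 < M r) :
    ∃ X W, IsSpaceFormMap (-1) (patch .zero I J) X W (sliceForm .zero (-1) M) := by
  have hM1 := contDiffOn_comp_radial (I := I) (k := .zero) hM
  have hMi : ContDiffOn ℝ ∞ (fun y : Coord => (M (y 1))⁻¹) (patch .zero I J) :=
    hM1.inv fun y hy => (hM0 _ hy.2.1).ne'
  have c2 : ContDiff ℝ ∞ fun y : Coord => y 2 := contDiff_apply ℝ ℝ (2 : Fin 4)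
  have c3 : ContDiff ℝ ∞ fun y : Coord => y 3 := contDiff_apply ℝ ℝ (3 : Fin 4)
  have hMs : ContDiffOn ℝ ∞ (fun y : Coord => M (y 1) * y 2 ^ 2) (patch .zero I J) :=
    hM1.mul (c2.pow 2).contDiffOn
  refine ⟨![fun y => M (y 1) * y 2 * Real.cos (y 3), fun y => M (y 1) * y 2 * Real.sin (y 3),
    fun y => (M (y 1) - (M (y 1))⁻¹ - M (y 1) * y 2 ^ 2) / 2],
    fun y => (M (y 1) + (M (y 1))⁻¹ + M (y 1) * y 2 ^ 2) / 2, fun a => ?_, ?_, ?_, ?_, ?_⟩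
  · fin_cases a
    · exact (hM1.mul c2.contDiffOn).mul c3.cos.contDiffOn
    · exact (hM1.mul c2.contDiffOn).mul c3.sin.contDiffOn
    · exact ((hM1.sub hMi).sub hMs).div_const 2
  · exact ((hM1.add hMi).add hMs).div_const 2
  · intro x hx
    have := hM0 _ hx.2.1
    have : 0 < (M (x 1) + (M (x 1))⁻¹ + M (x 1) * x 2 ^ 2) / 2 := by positivity
    linarith
  · intro x hx
    have hm := (hM0 _ hx.2.1).ne'
    simp only [Fin.sum_univ_three, Matrix.cons_val, SignType.coe_neg, SignType.coe_one]
    linear_combination -M (x 1) ^ 2 * x 2 ^ 2 * Real.sin_sq_add_cos_sq (x 3) +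
      mul_inv_cancel₀ hm
  · intro x hx i j
    have hm := (hM0 _ hx.2.1).ne'
    have hd : HasDerivAt M (deriv M (x 1)) (x 1) :=
      ((hM.contDiffAt (hJ.mem_nhds hx.2.1)).differentiableAt (by simp)).hasDerivAt
    have hdi := hd.inv hm
    have hds := hd.mul_const (x 2 ^ 2)
    have hsq : HasDerivAt (fun θ => M (x 1) * θ ^ 2) (M (x 1) * (2 * x 2)) (x 2) :=
      ((hasDerivAt_pow 2 (x 2)).const_mul (M (x 1))).congr_deriv (by norm_num)
    have d1 : deriv (fun s => (M s - (M s)⁻¹ - M s * x 2 ^ 2) / 2) (x 1) = _ :=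
      (((hd.sub hdi).sub hds).div_const 2).deriv
    have d2 : deriv (fun s => (M s + (M s)⁻¹ + M s * x 2 ^ 2) / 2) (x 1) = _ :=
      (((hd.add hdi).add hds).div_const 2).deriv
    have d3 : deriv (fun s => (M (x 1) - (M (x 1))⁻¹ - M (x 1) * s ^ 2) / 2) (x 2) = _ :=
      ((hsq.const_sub (M (x 1) - (M (x 1))⁻¹)).div_const 2).deriv
    have d4 : deriv (fun s => (M (x 1) + (M (x 1))⁻¹ + M (x 1) * s ^ 2) / 2) (x 2) = _ :=
      ((hsq.const_add (M (x 1) + (M (x 1))⁻¹)).div_const 2).deriv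
    have p0 := fun i => pd_spatial (fun r θ φ => M r * θ * Real.cos φ) i x
    have p1 := fun i => pd_spatial (fun r θ φ => M r * θ * Real.sin φ) i x
    have p2 := fun i => pd_spatial (fun r θ _ => (M r - (M r)⁻¹ - M r * θ ^ 2) / 2) i x
    have p3 := fun i => pd_spatial (fun r θ _ => (M r + (M r)⁻¹ + M r * θ ^ 2) / 2) i x
    simp only [Fin.sum_univ_three, Matrix.cons_val, p0, p1, p2, p3, d1, d2, d3, d4]
    have q3 := Real.sin_sq_add_cos_sq (x 3)
    fin_cases i <;> fin_cases j <;> simp [sliceForm, orbitRadius, -mul_eq_zero]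
    · have : deriv M (x 1) ^ 2 / M (x 1) ^ 2 =
          -deriv M (x 1) * (-deriv M (x 1) / M (x 1) ^ 2) := by ring
      rw [this]
      linear_combination deriv M (x 1) ^ 2 * x 2 ^ 2 * q3
    · linear_combination M (x 1) * deriv M (x 1) * x 2 * q3
    · ring
    · linear_combination M (x 1) * deriv M (x 1) * x 2 * q3
    · linear_combination M (x 1) ^ 2 * q3
    · ring
    · ring
    · ring
    · linear_combination M (x 1) ^ 2 * x 2 ^ 2 * q3

end Slices

/-- A slice of constant time maps to the quadric of constant curvature `ε`. For `k ≤ 0` the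
condition `0 < k - ε M²` leaves only `ε = -1`. -/
theorem exists_spaceFormMap {I J : Set ℝ} {M : ℝ → ℝ} {k ε : SignType} (hJ : IsOpen J)
    (hM : ContDiffOn ℝ ∞ M J) (hM0 : ∀ r ∈ J, 0 < M r) (hJ₀ : J.Nonempty)
    (h : ∀ r ∈ J, 0 < (k : ℝ) - (ε : ℝ) * M r ^ 2) :
    ∃ X W, IsSpaceFormMap ε (patch k I J) X W (sliceForm k ε M) := by
  obtain ⟨r, hr⟩ := hJ₀
  have e := h r hr
  have := pow_pos (hM0 r hr) 2
  cases k
  · have hε : ε = -1 := by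
      cases ε
      · simp at e
      · rfl
      · simp at e; linarith
    subst hε
    exact exists_spaceFormMap_zero hJ hM hM0
  · have hε : ε = -1 := by
      cases ε
      · norm_num at e
      · rfl
      · norm_num at e; linarith
    subst hε
    exact exists_spaceFormMap_neg hJ hM hM0 fun r hr => by simpa using h r hr
  · exact exists_spaceFormMap_pos hJ hM fun r hr => by simpa using h r hr

/-! ### From an ideal gas solution to the reduced system -/

/-- A point of the patch with given `t` and `r`; `θ = 1` is admissible for each sign of `k`. -/
def basePoint (t r : ℝ) : Coord := ![t, r, 1, 0]

theorem basePoint_mem {k : SignType} {I J : Set ℝ} {t r : ℝ} (ht : t ∈ I) (hr : r ∈ J) :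
    basePoint t r ∈ patch k I J :=
  ⟨ht, hr, one_pos, fun _ => by simpa [basePoint] using by linarith [Real.pi_gt_three]⟩

theorem contDiff_basePoint : ContDiff ℝ ∞ fun q : ℝ × ℝ => basePoint q.1 q.2 := by
  refine contDiff_pi.2 fun a => ?_
  fin_cases a
  · exact contDiff_fst
  · exact contDiff_snd
  · exact contDiff_const
  · exact contDiff_const

theorem smoothOn₂_comp_basePoint {k : SignType} {I J : Set ℝ} {f : Coord → ℝ}
    (hf : ContDiffOn ℝ ∞ f (patch k I J)) : SmoothOn₂ I J fun t r => f (basePoint t r) :=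
  hf.comp contDiff_basePoint.contDiffOn fun _ hq => basePoint_mem hq.1 hq.2

theorem adiabaticIndex_sub_one (κ cᵥ : ℝ) : adiabaticIndex κ cᵥ - 1 = κ / cᵥ :=
  add_sub_cancel_left _ _

section Extraction

variable {I J : Set ℝ} {k : SignType} {lam Y : ℝ → ℝ → ℝ} {ρ p n e Θ s : Coord → ℝ} {κ cᵥ : ℝ}

/-- The components of the field equations that are not identically satisfied or redundant. -/
theorem field_eq_comoving (hI : IsOpen I) (hJ : IsOpen J) (h : IsAdmissible I J lam Y)
    (hs : IsPerfectFluidSolution (orbitMetric k lam Y) (patch k I J) comoving ρ p) {x : Coord}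
    (hx : x ∈ patch k I J) :
    einsteinBase k lam Y (x 0) (x 1) 0 0 = ρ x ∧ einsteinBase k lam Y (x 0) (x 1) 0 1 = 0 ∧
      einsteinBase k lam Y (x 0) (x 1) 1 1 = p x * Real.exp (2 * lam (x 0) (x 1)) ∧
      einsteinBase k lam Y (x 0) (x 1) 2 2 = p x * Y (x 0) (x 1) ^ 2 := by
  have f := hs.field_eq x hx
  simp only [einstein_orbitMetric hI hJ h hx, Fin.sum_univ_four] at f
  refine ⟨?_, ?_, ?_, ?_⟩
  · simpa [orbitMetric, comoving] using f 0 0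
  · simpa [orbitMetric, comoving] using f 0 1
  · simpa [orbitMetric, comoving] using f 1 1
  · simpa [orbitMetric, comoving] using f 2 2

/-- The equations of state express the matter density by the energy density and the pressure. -/
theorem IsClassicalIdealGas.matter_eq {g : Metric} {D : Set Coord} {u : Coord → Coord}
    (h : IsClassicalIdealGas g D u ρ p κ cᵥ n e Θ s) {x : Coord} (hx : x ∈ D) :
    n x = ρ x - p x / (adiabaticIndex κ cᵥ - 1) := by
  have := h.kappa_pos.ne'
  have := h.cv_pos.ne'
  rw [adiabaticIndex_sub_one, h.energy x hx, h.ideal x hx, h.caloric x hx]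
  field_simp
  ring

theorem pressure_eq_basePoint (hI : IsOpen I) (hJ : IsOpen J) (h : IsAdmissible I J lam Y)
    (hs : IsPerfectFluidSolution (orbitMetric k lam Y) (patch k I J) comoving ρ p) {x : Coord}
    (hx : x ∈ patch k I J) : p x = p (basePoint (x 0) (x 1)) := by
  have e1 := (field_eq_comoving hI hJ h hs hx).2.2.1
  have e2 := (field_eq_comoving hI hJ h hs (basePoint_mem hx.1 hx.2.1)).2.2.1
  exact mul_right_cancel₀ (Real.exp_pos _).ne' (e1.symm.trans e2)

theorem energy_eq_basePoint (hI : IsOpen I) (hJ : IsOpen J) (h : IsAdmissible I J lam Y)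
    (hs : IsPerfectFluidSolution (orbitMetric k lam Y) (patch k I J) comoving ρ p) {x : Coord}
    (hx : x ∈ patch k I J) : ρ x = ρ (basePoint (x 0) (x 1)) :=
  (field_eq_comoving hI hJ h hs hx).1.symm.trans
    (field_eq_comoving hI hJ h hs (basePoint_mem hx.1 hx.2.1)).1

theorem matter_eq_basePoint (hI : IsOpen I) (hJ : IsOpen J) (h : IsAdmissible I J lam Y)
    (hs : IsPerfectFluidSolution (orbitMetric k lam Y) (patch k I J) comoving ρ p)
    (hg : IsClassicalIdealGas (orbitMetric k lam Y) (patch k I J) comoving ρ p κ cᵥ n e Θ s)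
    {x : Coord} (hx : x ∈ patch k I J) : n x = n (basePoint (x 0) (x 1)) := by
  rw [hg.matter_eq hx, hg.matter_eq (basePoint_mem hx.1 hx.2.1),
    pressure_eq_basePoint hI hJ h hs hx, energy_eq_basePoint hI hJ h hs hx]

theorem reducedSystem (hI : IsOpen I) (hJ : IsOpen J) (h : IsAdmissible I J lam Y)
    (hs : IsPerfectFluidSolution (orbitMetric k lam Y) (patch k I J) comoving ρ p)
    (hg : IsClassicalIdealGas (orbitMetric k lam Y) (patch k I J) comoving ρ p κ cᵥ n e Θ s) :
    ReducedSystem I J k (adiabaticIndex κ cᵥ) lam Y (fun t r => p (basePoint t r))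
      (fun t r => n (basePoint t r)) := by
  have hb : ∀ {t r}, t ∈ I → r ∈ J → basePoint t r ∈ patch k I J := basePoint_mem
  have hE : ∀ t r, Real.exp (2 * lam t r) ≠ 0 := fun _ _ => (Real.exp_pos _).ne'
  have hY : ∀ t ∈ I, ∀ r ∈ J, Y t r ≠ 0 := fun t ht r hr => (h.Y_pos t ht r hr).ne'
  refine ⟨hI, hJ, ?_, h.smooth_lam, h.smooth_Y, smoothOn₂_comp_basePoint hs.smooth_p,
    smoothOn₂_comp_basePoint hg.smooth_n, h.Y_pos, ?_, h.Y_r_ne_zero, ?_, ?_, ?_, ?_, ?_⟩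
  · have := div_pos hg.kappa_pos hg.cv_pos
    rw [adiabaticIndex]; linarith
  · intro t ht r hr
    rw [hg.ideal _ (hb ht hr)]
    exact mul_pos (mul_pos hg.kappa_pos (hg.n_pos _ (hb ht hr))) (hg.temp_pos _ (hb ht hr))
  · intro t ht r hr
    have e1 : einsteinBase k lam Y t r 0 0 = _ := (field_eq_comoving hI hJ h hs (hb ht hr)).1
    have := hY t ht r hr
    have := hE t r
    rw [hg.matter_eq (hb ht hr), sub_add_cancel, ← e1]
    simp [einsteinBase]
    field_simp
  · intro t ht r hr
    have e1 : einsteinBase k lam Y t r 0 1 = _ := (field_eq_comoving hI hJ h hs (hb ht hr)).2.1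
    have := hY t ht r hr
    simp [einsteinBase, this] at e1
    linear_combination e1
  · intro t ht r hr
    have e1 : einsteinBase k lam Y t r 1 1 = p (basePoint t r) * Real.exp (2 * lam t r) :=
      (field_eq_comoving hI hJ h hs (hb ht hr)).2.2.1
    have := hY t ht r hr
    have := hE t r
    simp [einsteinBase] at e1
    field_simp at e1 ⊢
    linear_combination -e1
  · intro t ht r hr
    have e1 : einsteinBase k lam Y t r 2 2 = p (basePoint t r) * Y t r ^ 2 :=
      (field_eq_comoving hI hJ h hs (hb ht hr)).2.2.2
    have := hY t ht r hr
    have := hE t r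
    simp [einsteinBase] at e1
    field_simp at e1 ⊢
    linear_combination -e1
  · intro t ht r hr
    have e1 := hg.matter _ (hb ht hr)
    rw [divergence_comoving hI hJ h (hb ht hr)] at e1
    have e2 : pd 0 n (basePoint t r) = dt (fun t r => n (basePoint t r)) t r := by
      have : ∀ s, Function.update (basePoint t r) 0 s = basePoint s r := fun s => by
        ext i; fin_cases i <;> simp [basePoint]
      simp only [pd, this, dt]
      rfl
    rw [e2] at e1
    have e3 : dt (fun t r => n (basePoint t r)) t r + n (basePoint t r) *
      (dt lam t r + 2 * dt Y t r / Y t r) = 0 := e1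
    linear_combination e3

end Extraction

theorem modelPressure_eq_mul {κ γ n₀ p₀ R₀ R : ℝ} (hκ : κ ≠ 0) (hn₀ : n₀ ≠ 0) (hR₀ : 0 < R₀)
    (hR : 0 < R) :
    modelPressure γ p₀ R₀ R = κ * modelMatter n₀ R₀ R * modelTemperature κ γ n₀ p₀ R₀ R := by
  have e : (R₀ / R) ^ (3 * γ) = (R₀ / R) ^ (3 * (γ - 1)) * (R₀ / R) ^ 3 := by
    rw [← Real.rpow_natCast (R₀ / R) 3, ← Real.rpow_add (div_pos hR₀ hR)]
    congr 1
    push_cast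
    ring
  rw [modelPressure, modelMatter, modelTemperature, e]
  field_simp

/-- A classical ideal gas solution with two-dimensional orbits is a Friedmann model. -/
theorem exists_flrwModel {I J : Set ℝ} (hI : IsOpen I) (hI' : IsPreconnected I)
    (hI₀ : I.Nonempty) (hJ : IsOpen J) (hJ' : IsPreconnected J) (hJ₀ : J.Nonempty) {κ cᵥ : ℝ}
    {k : SignType} {lam Y : ℝ → ℝ → ℝ} {ρ p n e Θ s : Coord → ℝ} (h : IsAdmissible I J lam Y)
    (hs : IsPerfectFluidSolution (orbitMetric k lam Y) (patch k I J) comoving ρ p)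
    (hg : IsClassicalIdealGas (orbitMetric k lam Y) (patch k I J) comoving ρ p κ cᵥ n e Θ s) :
    ∃ (ε : SignType) (n₀ p₀ R₀ : ℝ) (R : ℝ → ℝ) (Ψ : Coord → Coord),
      IsFLRWModel ε (adiabaticIndex κ cᵥ) n₀ p₀ R₀ I R ∧
      ContDiffOn ℝ ∞ Ψ (patch k I J) ∧
      ∀ x ∈ patch k I J,
        Ψ x 0 = x 0 ∧
        0 < isotropicFactor ε (Ψ x) ∧
        pullback Ψ (flrwMetric ε R) x = orbitMetric k lam Y x ∧
        ρ x = modelEnergy (adiabaticIndex κ cᵥ) n₀ p₀ R₀ (R (x 0)) ∧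
        p x = modelPressure (adiabaticIndex κ cᵥ) p₀ R₀ (R (x 0)) ∧
        n x = modelMatter n₀ R₀ (R (x 0)) ∧
        Θ x = modelTemperature κ (adiabaticIndex κ cᵥ) n₀ p₀ R₀ (R (x 0)) := by
  obtain ⟨ε, n₀, p₀, R, M, hmodel, hM, hM0, hsep⟩ :=
    (reducedSystem hI hJ h hs hg).exists_model hI' hJ' hI₀ hJ₀
      fun t ht r hr => hg.n_pos _ (basePoint_mem ht hr)
  obtain ⟨t₀, ht₀⟩ := hI₀
  obtain ⟨X, W, hXW⟩ := exists_spaceFormMap (I := I) hJ hM hM0 hJ₀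
    fun r hr => (hsep t₀ ht₀ r hr).2.1
  refine ⟨ε, n₀, p₀, 1, R, stereographic X W, hmodel, hXW.contDiffOn_stereographic,
    fun x hx => ?_⟩
  obtain ⟨hY, hpos, hlam, hP, hN⟩ := hsep _ hx.1 _ hx.2.1
  have hp : p x = modelPressure (adiabaticIndex κ cᵥ) p₀ 1 (R (x 0)) :=
    (pressure_eq_basePoint hI hJ h hs hx).trans hP
  have hn : n x = modelMatter n₀ 1 (R (x 0)) :=
    (matter_eq_basePoint hI hJ h hs hg hx).trans hN
  refine ⟨rfl, ?_, ?_, ?_, hp, hn, ?_⟩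
  · rw [hXW.isotropicFactor_stereographic hx]
    exact div_pos two_pos (by linarith [hXW.W_gt x hx])
  · ext i j
    rw [hXW.pullback_stereographic (isOpen_patch k hI hJ) hx]
    have e11 : R (x 0) ^ 2 * (deriv M (x 1) ^ 2 / (k - ε * M (x 1) ^ 2)) =
        Real.exp (2 * lam (x 0) (x 1)) := by
      field_simp
      linear_combination -hlam
    have pt : ∀ i : Fin 4, pd i (fun y => y 0) x = ![1, 0, 0, 0] i := by
      intro i
      fin_cases i <;> simp [pd]
    rw [pt, pt]
    fin_cases i <;> fin_cases j <;> simp [sliceForm, orbitMetric, e11, hY] <;> ring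
  · have := hg.matter_eq hx
    rw [hn, hp] at this
    rw [modelEnergy, ← modelMatter, div_mul_eq_mul_div, ← modelPressure]
    linear_combination -this
  · have e1 := hg.ideal x hx
    have hnp := hg.n_pos x hx
    have hκ := hg.kappa_pos.ne'
    rw [hp, modelPressure_eq_mul hκ hmodel.n₀_pos.ne' one_pos (hmodel.pos _ hx.1), ← hn] at e1
    exact (mul_left_cancel₀ (mul_ne_zero hκ hnp.ne') e1).symm

/-! ### The Friedmann models as ideal gas solutions -/

section Converse

variable {I J : Set ℝ} {ε : SignType} {γ n₀ p₀ R₀ κ cᵥ : ℝ} {R : ℝ → ℝ}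

/-- The function `λ` of the Friedmann models in isotropic spherical coordinates. -/
noncomputable def isotropicLam (ε : SignType) (R : ℝ → ℝ) : ℝ → ℝ → ℝ :=
  fun t r => Real.log (R t / (1 + (ε : ℝ) / 4 * r ^ 2))

/-- The area radius of the Friedmann models in isotropic spherical coordinates. -/
noncomputable def isotropicRadius (ε : SignType) (R : ℝ → ℝ) : ℝ → ℝ → ℝ :=
  fun t r => R t * r / (1 + (ε : ℝ) / 4 * r ^ 2)

theorem hasDerivAt_isotropic (ε : SignType) (r : ℝ) :
    HasDerivAt (fun r : ℝ => 1 + (ε : ℝ) / 4 * r ^ 2) ((ε : ℝ) / 2 * r) r :=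
  (((hasDerivAt_pow 2 r).const_mul ((ε : ℝ) / 4)).const_add 1).congr_deriv (by push_cast; ring)

theorem IsFLRWModel.hasDerivAt (h : IsFLRWModel ε γ n₀ p₀ R₀ I R) (hI : IsOpen I) {t : ℝ}
    (ht : t ∈ I) : HasDerivAt R (deriv R t) t :=
  ((h.smooth.contDiffAt (hI.mem_nhds ht)).differentiableAt (by simp)).hasDerivAt

theorem IsFLRWModel.hasDerivAt_deriv (h : IsFLRWModel ε γ n₀ p₀ R₀ I R) (hI : IsOpen I) {t : ℝ}
    (ht : t ∈ I) : HasDerivAt (deriv R) (deriv (deriv R) t) t :=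
  (((h.smooth.deriv_of_isOpen hI (m := ∞) (by simp)).contDiffAt
    (hI.mem_nhds ht)).differentiableAt (by simp)).hasDerivAt

theorem dt_isotropicLam (h : IsFLRWModel ε γ n₀ p₀ R₀ I R) (hI : IsOpen I) {t r : ℝ} (ht : t ∈ I)
    (hr : 1 + (ε : ℝ) / 4 * r ^ 2 ≠ 0) : dt (isotropicLam ε R) t r = deriv R t / R t := by
  have hR := (h.pos t ht).ne'
  refine Eq.trans (((h.hasDerivAt hI ht).div_const _).log (div_ne_zero hR hr)).deriv ?_
  generalize 1 + (ε : ℝ) / 4 * r ^ 2 = f at hr ⊢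
  field_simp

theorem dr_isotropicLam (h : IsFLRWModel ε γ n₀ p₀ R₀ I R) {t r : ℝ} (ht : t ∈ I)
    (hr : 1 + (ε : ℝ) / 4 * r ^ 2 ≠ 0) :
    dr (isotropicLam ε R) t r = -((ε : ℝ) / 2 * r) / (1 + (ε : ℝ) / 4 * r ^ 2) := by
  have hR := (h.pos t ht).ne'
  refine Eq.trans ((((hasDerivAt_const r (R t)).div (hasDerivAt_isotropic ε r) hr).log
    (div_ne_zero hR hr))).deriv ?_
  simp only [Pi.div_apply]
  field_simp
  ring

theorem dt_dt_isotropicLam (h : IsFLRWModel ε γ n₀ p₀ R₀ I R) (hI : IsOpen I) {t r : ℝ}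
    (ht : t ∈ I) (hr : 1 + (ε : ℝ) / 4 * r ^ 2 ≠ 0) :
    dt (dt (isotropicLam ε R)) t r = deriv (deriv R) t / R t - deriv R t ^ 2 / R t ^ 2 := by
  have hR := (h.pos t ht).ne'
  rw [dt_congr (J := {r}) hI (fun s hs r' (hr' : r' = r) => dt_isotropicLam h hI hs (hr' ▸ hr)) ht
    rfl]
  refine Eq.trans ((h.hasDerivAt_deriv hI ht).div (h.hasDerivAt hI ht) hR).deriv ?_
  field_simp

theorem dt_isotropicRadius (R : ℝ → ℝ) (t r : ℝ) :
    dt (isotropicRadius ε R) t r = deriv R t * r / (1 + (ε : ℝ) / 4 * r ^ 2) := by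
  simp only [dt, isotropicRadius, mul_div_assoc, deriv_mul_const_field]

theorem dr_isotropicRadius (R : ℝ → ℝ) (t : ℝ) {r : ℝ} (hr : 1 + (ε : ℝ) / 4 * r ^ 2 ≠ 0) :
    dr (isotropicRadius ε R) t r =
      R t * (1 - (ε : ℝ) / 4 * r ^ 2) / (1 + (ε : ℝ) / 4 * r ^ 2) ^ 2 := by
  refine Eq.trans (((hasDerivAt_id r).const_mul (R t)).div (hasDerivAt_isotropic ε r) hr).deriv ?_
  simp only [id]
  congr 1
  ring

theorem dt_dt_isotropicRadius (R : ℝ → ℝ) (t r : ℝ) :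
    dt (dt (isotropicRadius ε R)) t r =
      deriv (deriv R) t * r / (1 + (ε : ℝ) / 4 * r ^ 2) := by
  have : dt (isotropicRadius ε R) = isotropicRadius ε (deriv R) := by
    ext t r; exact dt_isotropicRadius R t r
  rw [this, dt_isotropicRadius]

theorem dr_dt_isotropicRadius (R : ℝ → ℝ) (t : ℝ) {r : ℝ}
    (hr : 1 + (ε : ℝ) / 4 * r ^ 2 ≠ 0) : dr (dt (isotropicRadius ε R)) t r =
      deriv R t * (1 - (ε : ℝ) / 4 * r ^ 2) / (1 + (ε : ℝ) / 4 * r ^ 2) ^ 2 := by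
  have : dt (isotropicRadius ε R) = isotropicRadius ε (deriv R) := by
    ext t r; exact dt_isotropicRadius R t r
  rw [this, dr_isotropicRadius _ _ hr]

theorem dr_dr_isotropicRadius (hJ : IsOpen J)
    (hr : ∀ r ∈ J, 1 + (ε : ℝ) / 4 * r ^ 2 ≠ 0) (R : ℝ → ℝ) (t : ℝ) {r : ℝ} (hrJ : r ∈ J) :
    dr (dr (isotropicRadius ε R)) t r = -(R t * ((ε : ℝ) / 2 * r) *
      (3 - (ε : ℝ) / 4 * r ^ 2)) / (1 + (ε : ℝ) / 4 * r ^ 2) ^ 3 := by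
  rw [dr_congr (I := {t}) hJ (fun s _ r' hr' => dr_isotropicRadius R s (hr r' hr')) rfl hrJ]
  have h1 : HasDerivAt (fun r : ℝ => 1 - (ε : ℝ) / 4 * r ^ 2) (-((ε : ℝ) / 2 * r)) r :=
    (((hasDerivAt_pow 2 r).const_mul ((ε : ℝ) / 4)).const_sub 1).congr_deriv
      (by push_cast; ring)
  have h0 := hr r hrJ
  refine Eq.trans ((h1.const_mul (R t)).div ((hasDerivAt_isotropic ε r).pow 2)
    (pow_ne_zero 2 h0)).deriv ?_
  simp only [Pi.pow_apply]
  push_cast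
  field_simp
  ring

theorem IsFLRWModel.isAdmissible (h : IsFLRWModel ε γ n₀ p₀ R₀ I R)
    (hJ0 : ∀ r ∈ J, 0 < r ∧ 0 < 1 + (ε : ℝ) / 4 * r ^ 2 ∧ 1 - (ε : ℝ) / 4 * r ^ 2 ≠ 0) :
    IsAdmissible I J (isotropicLam ε R) (isotropicRadius ε R) := by
  have hR : ContDiffOn ℝ ∞ (fun q : ℝ × ℝ => R q.1) (I ×ˢ J) :=
    h.smooth.comp contDiff_fst.contDiffOn fun _ hq => hq.1
  have hF : ContDiffOn ℝ ∞ (fun q : ℝ × ℝ => 1 + (ε : ℝ) / 4 * q.2 ^ 2) (I ×ˢ J) :=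
    (contDiff_const.add (contDiff_const.mul (contDiff_snd.pow 2))).contDiffOn
  have hF0 : ∀ q ∈ I ×ˢ J, 1 + (ε : ℝ) / 4 * q.2 ^ 2 ≠ 0 := fun q hq => (hJ0 q.2 hq.2).2.1.ne'
  refine ⟨(hR.div hF hF0).log fun q hq => div_ne_zero (h.pos q.1 hq.1).ne' (hF0 q hq),
    (hR.mul contDiff_snd.contDiffOn).div hF hF0, fun t ht r hr => ?_, fun t ht r hr => ?_⟩
  · obtain ⟨h1, h2, -⟩ := hJ0 r hr
    exact div_pos (mul_pos (h.pos t ht) h1) h2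
  · obtain ⟨-, h2, h3⟩ := hJ0 r hr
    refine (dr_isotropicRadius R t h2.ne').trans_ne ?_
    exact div_ne_zero (mul_ne_zero (h.pos t ht).ne' h3) (pow_ne_zero 2 h2.ne')

theorem exp_isotropicLam (h : IsFLRWModel ε γ n₀ p₀ R₀ I R) {t r : ℝ} (ht : t ∈ I)
    (hr : 0 < 1 + (ε : ℝ) / 4 * r ^ 2) : Real.exp (2 * isotropicLam ε R t r) =
      R t ^ 2 / (1 + (ε : ℝ) / 4 * r ^ 2) ^ 2 := by
  have hp := div_pos (h.pos t ht) hr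
  rw [two_mul, Real.exp_add, isotropicLam, Real.exp_log hp, ← pow_two, div_pow]

theorem IsFLRWModel.einsteinBase_eq (h : IsFLRWModel ε γ n₀ p₀ R₀ I R) (hI : IsOpen I)
    (hJ : IsOpen J)
    (hJ0 : ∀ r ∈ J, 0 < r ∧ 0 < 1 + (ε : ℝ) / 4 * r ^ 2 ∧ 1 - (ε : ℝ) / 4 * r ^ 2 ≠ 0)
    {t r : ℝ} (ht : t ∈ I) (hr : r ∈ J) :
    einsteinBase .pos (isotropicLam ε R) (isotropicRadius ε R) t r =
      Matrix.diagonal ![modelEnergy γ n₀ p₀ R₀ (R t),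
        modelPressure γ p₀ R₀ (R t) * Real.exp (2 * isotropicLam ε R t r),
        modelPressure γ p₀ R₀ (R t) * isotropicRadius ε R t r ^ 2,
        modelPressure γ p₀ R₀ (R t) * isotropicRadius ε R t r ^ 2] := by
  obtain ⟨hr0, hF, hG⟩ := hJ0 r hr
  have hne : ∀ r ∈ J, 1 + (ε : ℝ) / 4 * r ^ 2 ≠ 0 := fun r hr => (hJ0 r hr).2.1.ne'
  have hR := (h.pos t ht).ne'
  rw [← h.friedmann t ht, ← h.pressure t ht]
  simp only [einsteinBase, dt_isotropicLam h hI ht hF.ne', dr_isotropicLam h ht hF.ne',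
    dt_dt_isotropicLam h hI ht hF.ne', dt_isotropicRadius, dr_isotropicRadius R t hF.ne',
    dt_dt_isotropicRadius, dr_dt_isotropicRadius R t hF.ne', dr_dr_isotropicRadius hJ hne R t hr,
    exp_isotropicLam h ht hF]
  simp only [isotropicRadius]
  -- eliminating `ε` in favour of the conformal factor `f` makes all denominators monomials
  obtain ⟨f, hf⟩ : ∃ f, f = 1 + (ε : ℝ) / 4 * r ^ 2 := ⟨_, rfl⟩
  have hε : (ε : ℝ) = 4 * (f - 1) / r ^ 2 := by rw [hf]; field_simp; ring
  rw [← hf] at hF ⊢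
  rw [hε]
  have hf0 := hF.ne'
  have hr' := hr0.ne'
  ext i j
  fin_cases i <;> fin_cases j <;> simp [-mul_eq_zero]
  · field_simp
    ring
  · field_simp
    simp
  · field_simp
    simp
  · field_simp
    ring
  · field_simp
    ring
  · field_simp
    ring

theorem IsFLRWModel.contDiffOn_comp {k : SignType} (h : IsFLRWModel ε γ n₀ p₀ R₀ I R) :
    ContDiffOn ℝ ∞ (fun x : Coord => R₀ / R (x 0)) (patch k I J) :=
  contDiffOn_const.div (h.smooth.comp (contDiff_apply ℝ ℝ (0 : Fin 4)).contDiffOn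
    fun _ hx => hx.1) fun x hx => (h.pos (x 0) hx.1).ne'

theorem IsFLRWModel.contDiffOn_rpow {k : SignType} (h : IsFLRWModel ε γ n₀ p₀ R₀ I R) (a : ℝ) :
    ContDiffOn ℝ ∞ (fun x : Coord => (R₀ / R (x 0)) ^ a) (patch k I J) :=
  h.contDiffOn_comp.rpow_const_of_ne fun x hx => (div_pos h.R₀_pos (h.pos (x 0) hx.1)).ne'

theorem IsFLRWModel.isPerfectFluidSolution (h : IsFLRWModel ε γ n₀ p₀ R₀ I R) (hI : IsOpen I)
    (hJ : IsOpen J)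
    (hJ0 : ∀ r ∈ J, 0 < r ∧ 0 < 1 + (ε : ℝ) / 4 * r ^ 2 ∧ 1 - (ε : ℝ) / 4 * r ^ 2 ≠ 0) :
    IsPerfectFluidSolution (orbitMetric .pos (isotropicLam ε R) (isotropicRadius ε R))
      (patch .pos I J) comoving (fun x => modelEnergy γ n₀ p₀ R₀ (R (x 0)))
      (fun x => modelPressure γ p₀ R₀ (R (x 0))) := by
  refine ⟨?_, ?_, ?_, ?_⟩
  · exact (contDiffOn_const.mul (h.contDiffOn_comp.pow 3)).add
      (contDiffOn_const.mul (h.contDiffOn_rpow _))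
  · exact contDiffOn_const.mul (h.contDiffOn_rpow _)
  · intro x _
    simp [Fin.sum_univ_four, orbitMetric, comoving]
  · intro x hx b c
    rw [einstein_orbitMetric hI hJ (h.isAdmissible hJ0) hx,
      h.einsteinBase_eq hI hJ hJ0 hx.1 hx.2.1]
    simp only [Fin.sum_univ_four, orbitMetric, comoving]
    fin_cases b <;> fin_cases c <;> simp
    ring

theorem hasDerivAt_modelTemperature (κ γ n₀ p₀ : ℝ) (hR₀ : 0 < R₀) {t R' : ℝ} (hR : 0 < R t)
    (h : HasDerivAt R R' t) : HasDerivAt (fun t => modelTemperature κ γ n₀ p₀ R₀ (R t))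
      (-(3 * (γ - 1)) * modelTemperature κ γ n₀ p₀ R₀ (R t) * (R' / R t)) t := by
  have hz := (div_pos hR₀ hR).ne'
  refine (((((hasDerivAt_const t R₀).div h hR.ne').rpow_const (p := 3 * (γ - 1))
    (Or.inl hz))).const_mul (p₀ / (κ * n₀))).congr_deriv ?_
  simp only [Pi.div_apply, modelTemperature]
  rw [Real.rpow_sub_one hz]
  have := hR.ne'
  have := hR₀.ne'
  field_simp
  ring

theorem hasDerivAt_modelMatter (n₀ : ℝ) {t R' : ℝ} (hR : R t ≠ 0)
    (h : HasDerivAt R R' t) : HasDerivAt (fun t => modelMatter n₀ R₀ (R t))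
      (-3 * modelMatter n₀ R₀ (R t) * (R' / R t)) t := by
  refine ((((hasDerivAt_const t R₀).div h hR).pow 3).const_mul n₀).congr_deriv ?_
  simp only [Pi.div_apply, modelMatter]
  push_cast
  field_simp
  ring

theorem pd_time (f : ℝ → ℝ) (i : Fin 4) (x : Coord) :
    pd i (fun y => f (y 0)) x = if i = 0 then deriv f (x 0) else 0 := by
  fin_cases i <;> simp [pd]

/-- In a Friedmann model of an ideal gas the specific entropy is constant. -/
theorem IsFLRWModel.isClassicalIdealGas (hκ : 0 < κ) (hc : 0 < cᵥ)
    (h : IsFLRWModel ε (adiabaticIndex κ cᵥ) n₀ p₀ R₀ I R) (hI : IsOpen I) (hJ : IsOpen J)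
    (hJ0 : ∀ r ∈ J, 0 < r ∧ 0 < 1 + (ε : ℝ) / 4 * r ^ 2 ∧ 1 - (ε : ℝ) / 4 * r ^ 2 ≠ 0) :
    IsClassicalIdealGas (orbitMetric .pos (isotropicLam ε R) (isotropicRadius ε R))
      (patch .pos I J) comoving
      (fun x => modelEnergy (adiabaticIndex κ cᵥ) n₀ p₀ R₀ (R (x 0)))
      (fun x => modelPressure (adiabaticIndex κ cᵥ) p₀ R₀ (R (x 0))) κ cᵥ
      (fun x => modelMatter n₀ R₀ (R (x 0)))
      (fun x => cᵥ * modelTemperature κ (adiabaticIndex κ cᵥ) n₀ p₀ R₀ (R (x 0)))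
      (fun x => modelTemperature κ (adiabaticIndex κ cᵥ) n₀ p₀ R₀ (R (x 0)))
      (fun _ => 0) := by
  have hz : ∀ x ∈ patch .pos I J, 0 < R₀ / R (x 0) := fun x hx =>
    div_pos h.R₀_pos (h.pos _ hx.1)
  have smooth_Θ : ContDiffOn ℝ ∞ (fun x : Coord =>
      modelTemperature κ (adiabaticIndex κ cᵥ) n₀ p₀ R₀ (R (x 0))) (patch .pos I J) :=
    contDiffOn_const.mul (h.contDiffOn_rpow _)
  have n_pos : ∀ x ∈ patch .pos I J, 0 < modelMatter n₀ R₀ (R (x 0)) := fun x hx =>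
    mul_pos h.n₀_pos (pow_pos (hz x hx) 3)
  have ideal : ∀ x ∈ patch .pos I J, modelPressure (adiabaticIndex κ cᵥ) p₀ R₀ (R (x 0)) =
      κ * modelMatter n₀ R₀ (R (x 0)) *
        modelTemperature κ (adiabaticIndex κ cᵥ) n₀ p₀ R₀ (R (x 0)) := fun x hx =>
    modelPressure_eq_mul hκ.ne' h.n₀_pos.ne' h.R₀_pos (h.pos _ hx.1)
  refine ⟨hκ, hc, contDiffOn_const.mul (h.contDiffOn_comp.pow 3), contDiffOn_const.mul smooth_Θ,
    smooth_Θ, contDiffOn_const, n_pos, fun x hx => ?_, fun x hx => ?_, fun x hx => ?_,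
    fun x hx i => ?_, ideal, fun _ _ => rfl⟩
  · exact mul_pos (div_pos h.p₀_pos (mul_pos hκ h.n₀_pos)) (Real.rpow_pos_of_pos (hz x hx) _)
  · have e := ideal x hx
    rw [modelPressure] at e
    rw [modelEnergy, ← modelMatter, adiabaticIndex_sub_one, div_mul_eq_mul_div, e]
    field_simp
  · have hR := (h.pos _ hx.1).ne'
    have hF := (hJ0 _ hx.2.1).2.1.ne'
    have hr := (hJ0 _ hx.2.1).1.ne'
    rw [divergence_comoving hI hJ (h.isAdmissible hJ0) hx,
      pd_time (fun t => modelMatter n₀ R₀ (R t)), if_pos rfl,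
      (hasDerivAt_modelMatter n₀ hR (h.hasDerivAt hI hx.1)).deriv,
      dt_isotropicLam h hI hx.1 hF, dt_isotropicRadius, isotropicRadius]
    generalize 1 + (ε : ℝ) / 4 * x 1 ^ 2 = f at hF ⊢
    field_simp
    ring
  · have hR := h.pos _ hx.1
    have hn := (n_pos x hx).ne'
    have dn := (hasDerivAt_modelMatter (R₀ := R₀) n₀ hR.ne' (h.hasDerivAt hI hx.1))
    have dΘ := hasDerivAt_modelTemperature κ (adiabaticIndex κ cᵥ) n₀ p₀ h.R₀_pos hR
      (h.hasDerivAt hI hx.1)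
    have di : deriv (fun t => 1 / modelMatter n₀ R₀ (R t)) (x 0) = _ :=
      ((hasDerivAt_const (x 0) (1 : ℝ)).div dn hn).deriv
    rw [pd_time (fun t => cᵥ * modelTemperature κ (adiabaticIndex κ cᵥ) n₀ p₀ R₀ (R t)),
      pd_time (fun t => 1 / modelMatter n₀ R₀ (R t)), pd_time (fun _ => 0)]
    split_ifs
    · rw [(dΘ.const_mul cᵥ).deriv, di, ideal x hx, adiabaticIndex_sub_one, deriv_const]
      have := hR.ne'
      field_simp
      ring
    · simp

end Converse

end CIG

theorem proposition10 (I J : Set ℝ)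
    (hI : IsOpen I) (hI' : IsPreconnected I) (hI₀ : I.Nonempty)
    (hJ : IsOpen J) (hJ' : IsPreconnected J) (hJ₀ : J.Nonempty)
    (κ cᵥ : ℝ) (hκ : 0 < κ) (hcᵥ : 0 < cᵥ) :
    -- every classical ideal gas solution of the class is one of the FLRW models
    (∀ (k : SignType) (lam Y : ℝ → ℝ → ℝ) (ρ p n e Θ s : CIG.Coord → ℝ),
      CIG.IsAdmissible I J lam Y →
      CIG.IsPerfectFluidSolution (CIG.orbitMetric k lam Y) (CIG.patch k I J) CIG.comoving ρ p →
      CIG.IsClassicalIdealGas (CIG.orbitMetric k lam Y) (CIG.patch k I J) CIG.comoving ρ p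
        κ cᵥ n e Θ s →
      ∃ (ε : SignType) (n₀ p₀ R₀ : ℝ) (R : ℝ → ℝ) (Ψ : CIG.Coord → CIG.Coord),
        CIG.IsFLRWModel ε (CIG.adiabaticIndex κ cᵥ) n₀ p₀ R₀ I R ∧
        ContDiffOn ℝ ∞ Ψ (CIG.patch k I J) ∧
        ∀ x ∈ CIG.patch k I J,
          Ψ x 0 = x 0 ∧
          0 < CIG.isotropicFactor ε (Ψ x) ∧
          CIG.pullback Ψ (CIG.flrwMetric ε R) x = CIG.orbitMetric k lam Y x ∧
          ρ x = CIG.modelEnergy (CIG.adiabaticIndex κ cᵥ) n₀ p₀ R₀ (R (x 0)) ∧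
          p x = CIG.modelPressure (CIG.adiabaticIndex κ cᵥ) p₀ R₀ (R (x 0)) ∧
          n x = CIG.modelMatter n₀ R₀ (R (x 0)) ∧
          Θ x = CIG.modelTemperature κ (CIG.adiabaticIndex κ cᵥ) n₀ p₀ R₀ (R (x 0))) ∧
    -- conversely, each of these FLRW models, in isotropic spherical coordinates, is such a solution
    (∀ (ε : SignType) (n₀ p₀ R₀ : ℝ) (R : ℝ → ℝ),
      CIG.IsFLRWModel ε (CIG.adiabaticIndex κ cᵥ) n₀ p₀ R₀ I R →
      (∀ r ∈ J, 0 < r ∧ 0 < 1 + (ε : ℝ) / 4 * r ^ 2 ∧ 1 - (ε : ℝ) / 4 * r ^ 2 ≠ 0) →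
      ∀ lam Y : ℝ → ℝ → ℝ,
        (∀ t r, lam t r = Real.log (R t / (1 + (ε : ℝ) / 4 * r ^ 2))) →
        (∀ t r, Y t r = R t * r / (1 + (ε : ℝ) / 4 * r ^ 2)) →
        CIG.IsAdmissible I J lam Y ∧
        CIG.IsPerfectFluidSolution (CIG.orbitMetric .pos lam Y) (CIG.patch .pos I J) CIG.comoving
          (fun x => CIG.modelEnergy (CIG.adiabaticIndex κ cᵥ) n₀ p₀ R₀ (R (x 0)))
          (fun x => CIG.modelPressure (CIG.adiabaticIndex κ cᵥ) p₀ R₀ (R (x 0))) ∧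
        ∃ e s : CIG.Coord → ℝ,
          CIG.IsClassicalIdealGas (CIG.orbitMetric .pos lam Y) (CIG.patch .pos I J) CIG.comoving
            (fun x => CIG.modelEnergy (CIG.adiabaticIndex κ cᵥ) n₀ p₀ R₀ (R (x 0)))
            (fun x => CIG.modelPressure (CIG.adiabaticIndex κ cᵥ) p₀ R₀ (R (x 0)))
            κ cᵥ
            (fun x => CIG.modelMatter n₀ R₀ (R (x 0))) e
            (fun x => CIG.modelTemperature κ (CIG.adiabaticIndex κ cᵥ) n₀ p₀ R₀ (R (x 0))) s) := by
  refine ⟨fun k lam Y ρ p n e Θ s h hs hg =>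
    CIG.exists_flrwModel hI hI' hI₀ hJ hJ' hJ₀ h hs hg,
    fun ε n₀ p₀ R₀ R h hJ0 lam Y hlam hY => ?_⟩
  obtain rfl : lam = CIG.isotropicLam ε R := funext₂ hlam
  obtain rfl : Y = CIG.isotropicRadius ε R := funext₂ hY
  exact ⟨h.isAdmissible hJ0, h.isPerfectFluidSolution hI hJ hJ0, _, _,
    h.isClassicalIdealGas hκ hcᵥ hI hJ hJ0⟩
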